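/- Let $(n_k)_{k\ge 1}$ be a sequence of positive integers satisfying the Hadamard gap condition $n_{k+1}/n_k\ge q>1$ for all $k\ge 1$, with some constant $q$. Say that $(n_k)$ satisfies condition $\mathbf B_2$ if for all nonzero integers $a,b$ there is a constant $K(a,b)$ such that for every nonzero integer $c$ the equation $a n_k+b n_l=c$ has at most $K(a,b)$ solutions $(k,l)$, $k,l\ge 1$. If $(n_k)$ does not satisfy condition $\mathbf B_2$, then there exist a measurable function $f:\mathbb R\to\mathbb R$ with $f(x+1)=f(x)$ for all $x$, $\int_0^1 f(x)\,dx=0$ and bounded variation on $[0,1]$, and a permutation $\sigma$ of the positive integers, such that the limit $$\gamma=\lim_{N\to\infty}\frac1N\int_0^1\Big(\sum_{k=1}^N f(n_{\sigma(k)}x)\Big)^2dx$$ exists and is finite, but the normed sums $N^{-1/2}\sum_{k=1}^N f(n_{\sigma(k)}x)$, regarded as random variables on $(0,1)$ with Lebesgue measure, do not converge in distribution, as $N\to\infty$, to any (possibly degenerate) Gaussian distribution. -/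

import Mathlib

open MeasureTheory ProbabilityTheory Filter Topology

/-- The Hadamard gap condition `n_{k+1} / n_k ≥ q > 1` for a sequence of natural numbers. -/
def HadamardLacunary (n : ℕ → ℕ) : Prop :=
  ∃ q : ℝ, 1 < q ∧ ∀ k : ℕ, q ≤ (n (k + 1) : ℝ) / (n k : ℝ)

/-- Condition `B₂`: for all nonzero integers `a`, `b` there is a constant `K = K(a, b)` such that,
for every nonzero integer `c`, the equation `a * n_k + b * n_l = c` has at most `K` solutions
`(k, l)`. The cardinality is an extended natural number, so it is infinite for infinite sets. -/
def ConditionB2 (n : ℕ → ℕ) : Prop :=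
  ∀ a b : ℤ, a ≠ 0 → b ≠ 0 → ∃ K : ℕ, ∀ c : ℤ, c ≠ 0 →
    {p : ℕ × ℕ | a * (n p.1 : ℤ) + b * (n p.2 : ℤ) = c}.encard ≤ (K : ℕ∞)

/-- The standing assumptions on `f`: measurable, of period one, of mean zero, and of bounded
variation on the unit interval. -/
structure AdmissibleFunction (f : ℝ → ℝ) : Prop where
  measurable : Measurable f
  periodic : ∀ x : ℝ, f (x + 1) = f x
  integral_eq_zero : ∫ x in (0 : ℝ)..1, f x = 0
  boundedVariation : BoundedVariationOn f (Set.Icc 0 1)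

/-- The partial sum of the first `N` terms of the permuted sequence `f (n_{σ(k)} x)`. -/
noncomputable def permutedSum (f : ℝ → ℝ) (n : ℕ → ℕ) (σ : Equiv.Perm ℕ) (N : ℕ) (x : ℝ) : ℝ :=
  ∑ k ∈ Finset.range N, f ((n (σ k) : ℝ) * x)

/-- The normed partial sum `N ^ (-1/2) * ∑ f (n_{σ(k)} x)`. -/
noncomputable def normedSum (f : ℝ → ℝ) (n : ℕ → ℕ) (σ : Equiv.Perm ℕ) (N : ℕ) (x : ℝ) : ℝ :=
  (Real.sqrt N)⁻¹ * permutedSum f n σ N x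

/-- The unit interval `(0, 1)` with Lebesgue measure is a probability space. -/
instance isProbabilityMeasure_volume_Ioo :
    IsProbabilityMeasure ((volume : Measure ℝ).restrict (Set.Ioo 0 1)) :=
  ⟨by simp⟩

/-! If `B₂` fails, there are nonzero `a`, `b` such that `a n_k + b n_l = c` has, for suitable `c ≠
0`, as many solutions as desired. By lacunarity one can select among them solutions that lie far
apart and whose two terms are both large against `c` (`exists_separated_solutions`). This excludes
`|a| = |b|`.

Take `f(x) = cos 2πax + cos 2πbx`. For a pair `X = f(n_k x) + f(n_l x)`, twice the product of `cos
2πa n_k x` and `cos 2πb n_l x` contains `cos 2πcx`, so `X² = 2 + cos 2πcx` plus high frequencies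
(`pairSum_sq`). A block of pairs with common `c` therefore behaves like a mixture of centred
Gaussians with random variance proportional to `2 + cos 2πcx`. To see this, replace each `exp(ilX)`
by `1 + ilX - l²X²/2`. In the product over the block the widely separated high frequencies integrate
to zero (`integral_prod_add_eq`), which leaves the integral of `(1 - l²(2 + cos 2πcx)/2)^K`, close
to that of `exp(-K l²(2 + cos 2πcx)/2)` (`norm_charFun_block_sub_le`). The latter does not depend on
`c`.

The permutation lists the pairs block after block and puts the unused indices at the sparse
positions `2^i`. Since `c ≠ 0`, the functions `f(n_k x)` in the list are still orthonormal, so `γ =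
1`. Each block outweighs all its predecessors, so at block ends the characteristic functions tend to
`cosLaplace (t² / 4)`. A Gaussian limit would make `cosLaplace` an exponential, which
`cosLaplace_two_ne` excludes. -/

/-! ### Trigonometric polynomials and orthogonality of separated frequencies -/

/-- The character `x ↦ exp (2 π i m x)`. -/
noncomputable def expChar (m : ℤ) (x : ℝ) : ℂ :=
  Complex.exp (2 * Real.pi * Complex.I * m * x)

/-- The trigonometric polynomials with frequencies in `S`. -/
noncomputable def trigPoly (S : Set ℤ) : Submodule ℂ (ℝ → ℂ) :=
  Submodule.span ℂ (expChar '' S)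

/-- The trigonometric polynomials of degree at most `d`. -/
noncomputable abbrev lowTrig (d : ℕ) : Submodule ℂ (ℝ → ℂ) := trigPoly {m | m.natAbs ≤ d}

/-- The trigonometric polynomials with all frequencies of size at least `d`. -/
noncomputable abbrev highTrig (d : ℕ) : Submodule ℂ (ℝ → ℂ) := trigPoly {m | d ≤ m.natAbs}

theorem expChar_mem {S : Set ℤ} {m : ℤ} (hm : m ∈ S) : expChar m ∈ trigPoly S :=
  Submodule.subset_span ⟨m, hm, rfl⟩

theorem expChar_mul (m k : ℤ) : expChar m * expChar k = expChar (m + k) := by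
  funext x
  simp only [Pi.mul_apply, expChar, ← Complex.exp_add]
  congr 1
  push_cast
  ring

theorem trigPoly_mono {S S' : Set ℤ} (h : S ⊆ S') : trigPoly S ≤ trigPoly S' :=
  Submodule.span_mono (Set.image_mono h)

theorem lowTrig_mono {d d' : ℕ} (h : d ≤ d') : lowTrig d ≤ lowTrig d' :=
  trigPoly_mono fun _ hm => le_trans hm h

theorem mul_mem_trigPoly {S S' S'' : Set ℤ} (h : ∀ m ∈ S, ∀ k ∈ S', m + k ∈ S'')
    {p q : ℝ → ℂ} (hp : p ∈ trigPoly S) (hq : q ∈ trigPoly S') : p * q ∈ trigPoly S'' := by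
  induction hp using Submodule.span_induction with
  | mem p hp =>
    obtain ⟨m, hm, rfl⟩ := hp
    induction hq using Submodule.span_induction with
    | mem q hq =>
      obtain ⟨k, hk, rfl⟩ := hq
      rw [expChar_mul]
      exact expChar_mem (h m hm k hk)
    | zero => simp
    | add q q' _ _ h1 h2 => rw [mul_add]; exact add_mem h1 h2
    | smul c q _ h1 => rw [mul_smul_comm]; exact Submodule.smul_mem _ _ h1
  | zero => simp
  | add q q' _ _ h1 h2 => rw [add_mul]; exact add_mem h1 h2
  | smul c q _ h1 => rw [smul_mul_assoc]; exact Submodule.smul_mem _ _ h1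

theorem continuous_of_mem_trigPoly {S : Set ℤ} {p : ℝ → ℂ} (hp : p ∈ trigPoly S) :
    Continuous p := by
  induction hp using Submodule.span_induction with
  | mem p hp =>
    obtain ⟨m, hm, rfl⟩ := hp
    unfold expChar
    fun_prop
  | zero => exact continuous_zero
  | add q q' _ _ h1 h2 => exact h1.add h2
  | smul c q _ h1 => exact h1.const_smul c

theorem integral_expChar {m : ℤ} (hm : m ≠ 0) : ∫ x in (0 : ℝ)..1, expChar m x = 0 := by
  unfold expChar
  have hc : (2 * Real.pi * Complex.I * m : ℂ) ≠ 0 := by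
    simp [Real.pi_ne_zero, hm]
  rw [integral_exp_mul_complex hc]
  have : (2 * Real.pi * Complex.I * m : ℂ) * ((1 : ℝ) : ℂ) = m * (2 * Real.pi * Complex.I) := by
    push_cast; ring
  rw [this, Complex.exp_int_mul_two_pi_mul_I]
  simp

theorem integral_trigPoly {S : Set ℤ} (hS : (0 : ℤ) ∉ S) {p : ℝ → ℂ} (hp : p ∈ trigPoly S) :
    ∫ x in (0 : ℝ)..1, p x = 0 := by
  induction hp using Submodule.span_induction with
  | mem p hp =>
    obtain ⟨m, hm, rfl⟩ := hp
    exact integral_expChar fun h => hS (h ▸ hm)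
  | zero => simp
  | add q q' hq hq' h1 h2 =>
    simp only [Pi.add_apply]
    rw [intervalIntegral.integral_add
      ((continuous_of_mem_trigPoly hq).intervalIntegrable _ _)
      ((continuous_of_mem_trigPoly hq').intervalIntegrable _ _), h1, h2, add_zero]
  | smul c q _ h1 =>
    simp only [Pi.smul_apply]
    rw [intervalIntegral.integral_smul, h1, smul_zero]

theorem integral_low_mul_high {d M : ℕ} (h : d < M) {p q : ℝ → ℂ} (hp : p ∈ lowTrig d)
    (hq : q ∈ highTrig M) : ∫ x in (0 : ℝ)..1, p x * q x = 0 := by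
  have := mul_mem_trigPoly (S'' := {m : ℤ | m ≠ 0}) (fun m hm k hk => ?_) hp hq
  · exact integral_trigPoly (by simp) this
  · simp only [Set.mem_ofPred_eq] at hm hk ⊢
    omega

theorem one_mem_lowTrig (d : ℕ) : (1 : ℝ → ℂ) ∈ lowTrig d := by
  have : (1 : ℝ → ℂ) = expChar 0 := by funext x; simp [expChar]
  rw [this]
  exact expChar_mem (by simp)

theorem mul_mem_lowTrig {d d' : ℕ} {p q : ℝ → ℂ} (hp : p ∈ lowTrig d) (hq : q ∈ lowTrig d') :
    p * q ∈ lowTrig (d + d') :=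
  mul_mem_trigPoly (fun m hm k hk => by simp only [Set.mem_ofPred_eq] at *; omega) hp hq

theorem prod_mem_lowTrig {d r : ℕ} {P : ℕ → ℝ → ℂ} (hP : ∀ i < r, P i ∈ lowTrig d) :
    ∏ i ∈ Finset.range r, P i ∈ lowTrig (r * d) := by
  induction r with
  | zero => simpa using one_mem_lowTrig 0
  | succ r ih =>
    rw [Finset.prod_range_succ, Nat.succ_mul]
    exact mul_mem_lowTrig (ih fun i hi => hP i (by omega)) (hP r (by omega))

theorem pow_mem_lowTrig {d : ℕ} (r : ℕ) {V : ℝ → ℂ} (hV : V ∈ lowTrig d) :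
    V ^ r ∈ lowTrig (r * d) := by
  simpa using prod_mem_lowTrig (r := r) (P := fun _ => V) fun _ _ => hV

/-- If the frequencies of `Q r` exceed those of all products of `V` and `V + Q i`, `i < r`, then
the perturbations `Q r` do not contribute to the integral of the product. -/
theorem integral_prod_add_eq {K : ℕ} {V : ℝ → ℂ} {Q : ℕ → ℝ → ℂ} {d M : ℕ → ℕ}
    (hV : ∀ r < K, V ∈ lowTrig (d r)) (hP : ∀ r < K, ∀ i < r, V + Q i ∈ lowTrig (d r))
    (hQ : ∀ r < K, Q r ∈ highTrig (M r)) (hdM : ∀ r < K, K * d r < M r) :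
    ∫ x in (0 : ℝ)..1, ∏ i ∈ Finset.range K, (V x + Q i x) = ∫ x in (0 : ℝ)..1, V x ^ K := by
  -- The perturbations are switched on one at a time. Passing from `r` to `r + 1` adds `Q r` times a
  -- product of low degree, whose integral vanishes.
  have key : ∀ r ≤ K, ∫ x in (0 : ℝ)..1, ((∏ i ∈ Finset.range r, (V + Q i)) * V ^ (K - r)) x
      = ∫ x in (0 : ℝ)..1, V x ^ K := by
    intro r
    induction r with
    | zero => intro _; simp
    | succ r ih =>
      intro hr
      rw [← ih (by omega)]
      have hlow : (∏ i ∈ Finset.range r, (V + Q i)) * V ^ (K - (r + 1)) ∈ lowTrig (K * d r) := by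
        refine lowTrig_mono ?_ (mul_mem_lowTrig (prod_mem_lowTrig (hP r hr))
          (pow_mem_lowTrig (K - (r + 1)) (hV r hr)))
        rw [← Nat.add_mul]
        exact Nat.mul_le_mul_right _ (by omega)
      have hVc := continuous_of_mem_trigPoly (hV r hr)
      have hQc := continuous_of_mem_trigPoly (hQ r hr)
      have hlc := continuous_of_mem_trigPoly hlow
      have e1 : (∏ i ∈ Finset.range (r + 1), (V + Q i)) * V ^ (K - (r + 1)) =
          (∏ i ∈ Finset.range r, (V + Q i)) * V ^ (K - r)
          + ((∏ i ∈ Finset.range r, (V + Q i)) * V ^ (K - (r + 1))) * Q r := by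
        rw [Finset.prod_range_succ, show K - r = (K - (r + 1)) + 1 by omega, pow_succ]
        ring
      have e2 : (∏ i ∈ Finset.range r, (V + Q i)) * V ^ (K - r) =
          ((∏ i ∈ Finset.range r, (V + Q i)) * V ^ (K - (r + 1))) * V := by
        rw [show K - r = (K - (r + 1)) + 1 by omega, pow_succ]
        ring
      rw [e1]
      simp only [Pi.add_apply]
      rw [intervalIntegral.integral_add, add_eq_left]
      · exact integral_low_mul_high (hdM r hr) hlow (hQ r hr)
      · rw [e2]; exact (hlc.mul hVc).intervalIntegrable _ _
      · exact (hlc.mul hQc).intervalIntegrable _ _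
  have := key K le_rfl
  rw [← this]
  congr 1
  funext x
  simp [Finset.prod_apply]

/-! ### Cosines with integer frequency -/

/-- The cosine `x ↦ cos (2 π m x)`. -/
noncomputable def cosChar (m : ℤ) (x : ℝ) : ℝ := Real.cos (2 * Real.pi * m * x)

theorem continuous_cosChar (m : ℤ) : Continuous (cosChar m) := by
  unfold cosChar
  fun_prop

theorem cosChar_mul (m k : ℤ) (x : ℝ) :
    cosChar m x * cosChar k x = (cosChar (m + k) x + cosChar (m - k) x) / 2 := by
  have h : ∀ u v : ℝ, Real.cos u * Real.cos v = (Real.cos (u + v) + Real.cos (u - v)) / 2 := by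
    intro u v
    rw [Real.cos_add, Real.cos_sub]
    ring
  unfold cosChar
  rw [h]
  push_cast
  ring_nf

theorem cosChar_zero (x : ℝ) : cosChar 0 x = 1 := by simp [cosChar]

theorem cosChar_mem {S : Set ℤ} {m : ℤ} (hm : m ∈ S) (hm' : -m ∈ S) :
    (fun x => (cosChar m x : ℂ)) ∈ trigPoly S := by
  have : (fun x => (cosChar m x : ℂ)) = (1 / 2 : ℂ) • (expChar m + expChar (-m)) := by
    funext x
    simp only [cosChar, expChar, Complex.ofReal_cos, Pi.smul_apply, Pi.add_apply, smul_eq_mul,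
      Complex.cos]
    push_cast
    ring_nf
  rw [this]
  exact Submodule.smul_mem _ _ (add_mem (expChar_mem hm) (expChar_mem hm'))

theorem cosChar_mem_lowTrig {d : ℕ} {m : ℤ} (hm : m.natAbs ≤ d) :
    (fun x => (cosChar m x : ℂ)) ∈ lowTrig d :=
  cosChar_mem hm (by simpa using hm)

theorem integral_cosChar {m : ℤ} (hm : m ≠ 0) : ∫ x in (0 : ℝ)..1, cosChar m x = 0 := by
  have h := integral_trigPoly (S := {k | k ≠ 0}) (by simp) (cosChar_mem (m := m) hm (by simpa))
  rw [intervalIntegral.integral_ofReal] at h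
  exact_mod_cast h

/-- The integral over a period of a function of `cos (2 π c x)` does not depend on `c ≠ 0`. -/
theorem integral_comp_cosChar {E : Type*} [NormedAddCommGroup E] [NormedSpace ℝ E] {G : ℝ → E}
    (hG : Continuous G) {c : ℤ} (hc : c ≠ 0) :
    ∫ x in (0 : ℝ)..1, G (cosChar c x) = ∫ x in (0 : ℝ)..1, G (cosChar 1 x) := by
  have hper : Function.Periodic (fun x => G (cosChar 1 x)) 1 := by
    intro x
    simp only [cosChar]
    rw [show 2 * Real.pi * ((1 : ℤ) : ℝ) * (x + 1) = 2 * Real.pi * ((1 : ℤ) : ℝ) * x + 2 * Real.pi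
      by push_cast; ring, Real.cos_add_two_pi]
  have hcont : Continuous fun x => G (cosChar 1 x) := hG.comp (continuous_cosChar 1)
  have h1 : ∀ x, G (cosChar c x) = (fun y => G (cosChar 1 y)) (c * x) := by
    intro x
    simp only [cosChar]
    push_cast
    ring_nf
  simp_rw [h1]
  have hc' : (c : ℝ) ≠ 0 := by exact_mod_cast hc
  rw [intervalIntegral.integral_comp_mul_left (fun y => G (cosChar 1 y)) hc']
  have := hper.intervalIntegral_add_zsmul_eq c 0 (fun a b => hcont.intervalIntegrable a b)
  simp only [zsmul_eq_mul, mul_one, zero_add] at this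
  rw [mul_zero, mul_one, this, ← Int.cast_smul_eq_zsmul ℝ, smul_smul, inv_mul_cancel₀ hc', one_smul]

/-! ### Perturbation of products and Taylor estimates -/

/-- Relative errors multiply: after division by `∏ z i`, which has norm at most one, the factors are
`1 + O(δ)`. -/
theorem norm_prod_sub_prod_le {K : ℕ} {z w : ℕ → ℂ} {δ : ℝ} (hz0 : ∀ i < K, z i ≠ 0)
    (hz : ∀ i < K, ‖z i‖ ≤ 1) (h : ∀ i < K, ‖w i - z i‖ ≤ δ * ‖z i‖) :
    ‖∏ i ∈ Finset.range K, w i - ∏ i ∈ Finset.range K, z i‖ ≤ Real.exp (K * δ) - 1 := by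
  have h1 : ∏ i ∈ Finset.range K, w i =
      (∏ i ∈ Finset.range K, z i) * ∏ i ∈ Finset.range K, (1 + (w i - z i) / z i) := by
    rw [← Finset.prod_mul_distrib]
    refine Finset.prod_congr rfl fun i hi => ?_
    have := hz0 i (Finset.mem_range.1 hi)
    field_simp
    ring
  have h2 : ‖∏ i ∈ Finset.range K, z i‖ ≤ 1 := by
    rw [norm_prod]
    exact Finset.prod_le_one (fun _ _ => norm_nonneg _) fun i hi => hz i (Finset.mem_range.1 hi)
  have h3 := Finset.norm_prod_one_add_sub_one_le (Finset.range K) fun i => (w i - z i) / z i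
  have h4 : ∑ i ∈ Finset.range K, ‖(w i - z i) / z i‖ ≤ K * δ := by
    have : ∀ i ∈ Finset.range K, ‖(w i - z i) / z i‖ ≤ δ := by
      intro i hi
      rw [norm_div, div_le_iff₀ (norm_pos_iff.2 (hz0 i (Finset.mem_range.1 hi)))]
      exact h i (Finset.mem_range.1 hi)
    simpa using Finset.sum_le_card_nsmul _ _ _ this
  rw [h1, ← mul_sub_one, norm_mul]
  calc _ ≤ 1 * ‖∏ i ∈ Finset.range K, (1 + (w i - z i) / z i) - 1‖ :=
        mul_le_mul_of_nonneg_right h2 (norm_nonneg _)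
    _ ≤ _ := by
        rw [one_mul]
        exact h3.trans (sub_le_sub_right (Real.exp_le_exp.2 h4) 1)

theorem norm_taylor_exp_mul_I_sub_le {y : ℝ} (hy : |y| ≤ 1) :
    ‖(1 + Complex.I * y - y ^ 2 / 2 : ℂ) - Complex.exp (Complex.I * y)‖ ≤ |y| ^ 3 := by
  have hn : ‖Complex.I * y‖ = |y| := by simp
  have h := Complex.exp_bound (x := Complex.I * y) (by rwa [hn]) (n := 3) (by norm_num)
  rw [norm_sub_rev] at h
  have e : ∑ m ∈ Finset.range 3, (Complex.I * y) ^ m / (m.factorial : ℂ) =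
      1 + Complex.I * y - y ^ 2 / 2 := by
    simp [Finset.sum_range_succ, mul_pow, Nat.factorial]
    ring
  rw [e, hn] at h
  refine h.trans ?_
  have : 0 ≤ |y| ^ 3 := by positivity
  norm_num [Nat.factorial]
  linarith

/-- The quadratic Taylor error becomes a relative one, as `norm_prod_sub_prod_le` requires, because
`exp (-y) ≥ 1/3` on the unit interval. -/
theorem abs_one_sub_sub_exp_neg_le {y : ℝ} (h0 : 0 ≤ y) (hy : y ≤ 1) :
    |1 - y - Real.exp (-y)| ≤ 3 * y ^ 2 * Real.exp (-y) := by
  have h1 : |-y| ≤ 1 := by rwa [abs_neg, abs_of_nonneg h0]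
  have h := Real.abs_exp_sub_one_sub_id_le h1
  have e : |1 - y - Real.exp (-y)| = |Real.exp (-y) - 1 - -y| := by
    rw [← abs_neg]; congr 1; ring
  rw [e]
  have h2 : Real.exp (-1) ≤ Real.exp (-y) := Real.exp_le_exp.2 (by linarith)
  have h3 : (1 / 3 : ℝ) ≤ Real.exp (-1) := by
    rw [Real.exp_neg, one_div]
    exact inv_anti₀ (Real.exp_pos 1) (by linarith [Real.exp_one_lt_d9])
  nlinarith [sq_nonneg y]

/-! ### The frequencies of a pair and of its square -/

/-- The function `cos (2 π a x) + cos (2 π b x)`. -/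
noncomputable def twoCos (a b : ℤ) (x : ℝ) : ℝ := cosChar a x + cosChar b x

theorem twoCos_mul (a b : ℤ) (n : ℕ) (x : ℝ) :
    twoCos a b (n * x) = cosChar (a * n) x + cosChar (b * n) x := by
  unfold twoCos cosChar
  push_cast
  ring_nf

theorem abs_twoCos_le (a b : ℤ) (x : ℝ) : |twoCos a b x| ≤ 2 := by
  unfold twoCos cosChar
  refine (abs_add_le _ _).trans ?_
  linarith [Real.abs_cos_le_one (2 * Real.pi * a * x), Real.abs_cos_le_one (2 * Real.pi * b * x)]

theorem continuous_twoCos (a b : ℤ) : Continuous (twoCos a b) :=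
  (continuous_cosChar a).add (continuous_cosChar b)

/-- The contribution `f (n x) + f (m x)` of a pair, `f = twoCos a b`. -/
noncomputable def pairSum (a b : ℤ) (n m : ℕ) (x : ℝ) : ℝ :=
  twoCos a b (n * x) + twoCos a b (m * x)

theorem abs_pairSum_le (a b : ℤ) (n m : ℕ) (x : ℝ) : |pairSum a b n m x| ≤ 4 := by
  refine (abs_add_le _ _).trans ?_
  linarith [abs_twoCos_le a b (n * x), abs_twoCos_le a b (m * x)]

theorem continuous_pairSum (a b : ℤ) (n m : ℕ) : Continuous (pairSum a b n m) := by
  have := continuous_twoCos a b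
  unfold pairSum
  fun_prop

/-- The source of the non-Gaussian limit: among the cross terms, only the product of the frequencies
`a * n` and `b * m` produces the small frequency `c`. The remaining terms are listed so that each
can be bounded from below. -/
theorem pairSum_sq {a b c : ℤ} {n m : ℕ} (h : a * n + b * m = c) (x : ℝ) :
    pairSum a b n m x ^ 2 = (2 + cosChar c x) +
      ((cosChar (2 * a * n) x + cosChar (2 * b * n) x + cosChar (2 * a * m) x
        + cosChar (2 * b * m) x) / 2
      + (cosChar ((a + b) * n) x + cosChar ((a - b) * n) x)
      + (cosChar (a * (n + m)) x + cosChar (a * (n - m)) x)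
      + cosChar (a * n - b * m) x
      + (cosChar (b * n + a * m) x + cosChar (b * n - a * m) x)
      + (cosChar (b * (n + m)) x + cosChar (b * (n - m)) x)
      + (cosChar ((a + b) * m) x + cosChar ((a - b) * m) x)) := by
  have hsq : ∀ t : ℤ, cosChar t x * cosChar t x = (cosChar (2 * t) x + 1) / 2 := by
    intro t
    rw [cosChar_mul, sub_self, cosChar_zero, two_mul]
  simp only [pairSum, twoCos_mul]
  have e1 := hsq (a * n)
  have e2 := hsq (b * n)
  have e3 := hsq (a * m)
  have e4 := hsq (b * m)
  have e5 := cosChar_mul (a * n) (b * n) x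
  have e6 := cosChar_mul (a * n) (a * m) x
  have e7 := cosChar_mul (a * n) (b * m) x
  have e8 := cosChar_mul (b * n) (a * m) x
  have e9 := cosChar_mul (b * n) (b * m) x
  have e10 := cosChar_mul (a * m) (b * m) x
  rw [h] at e7
  simp only [← mul_assoc, ← add_mul, ← sub_mul, ← mul_add, ← mul_sub] at e1 e2 e3 e4 e5 e6 e8 e9 e10
  linear_combination e1 + e2 + e3 + e4 + 2 * (e5 + e6 + e7 + e8 + e9 + e10)

theorem le_abs_mul_of_ne_zero {t y : ℤ} (ht : t ≠ 0) : |y| ≤ |t * y| := by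
  rw [abs_mul]
  exact le_mul_of_one_le_left (abs_nonneg y) (Int.one_le_abs ht)

theorem abs_mul_add_mul_le {u v : ℤ} {D n m e : ℤ} (hn : 0 ≤ n) (hm : 0 ≤ m)
    (huv : |u| + |v| ≤ 2 * D) (hne : 2 * D * n ≤ e) (hme : 2 * D * m ≤ e) :
    |u * n + v * m| ≤ e := by
  have h1 := abs_add_le (u * n) (v * m)
  rw [abs_mul, abs_mul, abs_of_nonneg hn, abs_of_nonneg hm] at h1
  refine h1.trans ?_
  rcases le_total n m with h | h
  · nlinarith [abs_nonneg u, abs_nonneg v]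
  · nlinarith [abs_nonneg u, abs_nonneg v]

section Frequencies

variable {a b c n m M : ℤ}

/-- Serves frequencies such as `a * (n - m) = c - (a + b) * m`, where the relation between `n` and
`m` leaves a nonzero multiple of one of them, up to `c`. -/
theorem le_abs_mul_sub {s t u : ℤ} (hs : s ≠ 0) (hu : 0 < u) (hM : 4 * M ≤ u)
    (hc : 4 * |c| ≤ u) (ht : t = s * u - c ∨ t = c - s * u) : M ≤ |t| := by
  have h1 : u ≤ |s * u| := (le_abs_self u).trans (le_abs_mul_of_ne_zero hs)
  have h2 : |s * u| - |c| ≤ |t| := by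
    rcases ht with rfl | rfl
    · exact abs_sub_abs_le_abs_sub _ _
    · rw [abs_sub_comm]; exact abs_sub_abs_le_abs_sub _ _
  have := abs_nonneg c
  omega

/-- Serves `t = b * n ± a * m`: multiplying by `a` and eliminating `a * n = c - b * m` leaves `b * c
+ s * m` with `s = ±a ^ 2 - b ^ 2`, nonzero as `|a| ≠ |b|`. -/
theorem le_abs_of_mul_eq {s t : ℤ} (ha : a ≠ 0) (hs : s ≠ 0)
    (hM : 2 * (|a| * M) ≤ m) (hc : 2 * (|b| * |c|) ≤ m) (ht : a * t = b * c + s * m) :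
    M ≤ |t| := by
  have h1 : m ≤ |s * m| := (le_abs_self m).trans (le_abs_mul_of_ne_zero hs)
  have h2 : |s * m| - |b * c| ≤ |a * t| := by
    rw [ht]
    have := abs_sub_abs_le_abs_sub (s * m) (-(b * c))
    rwa [abs_neg, sub_neg_eq_add, add_comm] at this
  rw [abs_mul a t, abs_mul b c] at h2
  have ha' : 0 < |a| := abs_pos.2 ha
  by_contra hlt
  push Not at hlt
  nlinarith

end Frequencies

/-- The frequencies which occur in a block are bounded below and above by the pair. -/
def pairFreq (M e : ℕ) : Set ℤ := {w | M ≤ w.natAbs ∧ w.natAbs ≤ e}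

theorem cosChar_mem_pairFreq {M e : ℕ} {w : ℤ} (h1 : (M : ℤ) ≤ |w|) (h2 : |w| ≤ (e : ℤ)) :
    (fun x => (cosChar w x : ℂ)) ∈ trigPoly (pairFreq M e) := by
  rw [Int.abs_eq_natAbs] at h1 h2
  have : w ∈ pairFreq M e := ⟨by exact_mod_cast h1, by exact_mod_cast h2⟩
  exact cosChar_mem this (by simpa [pairFreq] using this)

theorem pairSum_mem_trigPoly {a b : ℤ} (ha : a ≠ 0) (hb : b ≠ 0) (hab : |a| ≠ |b|) {c : ℤ}
    {n m M e : ℕ} (hn : 0 < n) (hm : 0 < m) (h : a * n + b * m = c)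
    (hnM : 2 * (|a| + |b|) * M ≤ n) (hmM : 2 * (|a| + |b|) * M ≤ m)
    (hnc : 2 * (|a| + |b|) * |c| ≤ n) (hmc : 2 * (|a| + |b|) * |c| ≤ m)
    (hne : 2 * (|a| + |b|) * n ≤ e) (hme : 2 * (|a| + |b|) * m ≤ e) :
    (fun x => (pairSum a b n m x : ℂ)) ∈ trigPoly (pairFreq M e) ∧
    (fun x => (pairSum a b n m x ^ 2 - (2 + cosChar c x) : ℂ)) ∈ trigPoly (pairFreq M e) := by
  have ha1 := Int.one_le_abs ha
  have hb1 := Int.one_le_abs hb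
  have hn' : (0 : ℤ) < n := by exact_mod_cast hn
  have hm' : (0 : ℤ) < m := by exact_mod_cast hm
  have hM0 : (0 : ℤ) ≤ M := by positivity
  have hc0 := abs_nonneg c
  have hadd : a + b ≠ 0 := fun h => hab (by rw [show a = -b by omega, abs_neg])
  have hsub : a - b ≠ 0 := fun h => hab (by rw [show a = b by omega])
  have hnM1 : 4 * (M : ℤ) ≤ n := by nlinarith
  have hmM1 : 4 * (M : ℤ) ≤ m := by nlinarith
  have hnc1 : 4 * |c| ≤ n := by nlinarith
  have hmc1 : 4 * |c| ≤ m := by nlinarith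
  have hup : ∀ u v : ℤ, |u| + |v| ≤ 2 * (|a| + |b|) → |u * n + v * m| ≤ (e : ℤ) := fun u v huv =>
    abs_mul_add_mul_le hn'.le hm'.le huv hne hme
  have key : ∀ u v w : ℤ, w = u * n + v * m → |u| + |v| ≤ 2 * (|a| + |b|) → (M : ℤ) ≤ |w| →
      (fun x => (cosChar w x : ℂ)) ∈ trigPoly (pairFreq M e) := by
    rintro u v w rfl huv hw
    exact cosChar_mem_pairFreq hw (hup u v huv)
  have lown : ∀ t : ℤ, t ≠ 0 → (M : ℤ) ≤ |t * n| := fun t ht => by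
    have := le_abs_mul_of_ne_zero (y := n) ht
    rw [abs_of_pos hn'] at this
    omega
  have lowm : ∀ t : ℤ, t ≠ 0 → (M : ℤ) ≤ |t * m| := fun t ht => by
    have := le_abs_mul_of_ne_zero (y := m) ht
    rw [abs_of_pos hm'] at this
    omega
  have lownm : ∀ t : ℤ, t ≠ 0 → (M : ℤ) ≤ |t * (n + m)| := fun t ht => by
    have := le_abs_mul_of_ne_zero (y := (n + m : ℤ)) ht
    rw [abs_of_pos (by omega)] at this
    omega
  have h2a : |2 * a| = 2 * |a| := by rw [abs_mul]; norm_num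
  have h2b : |2 * b| = 2 * |b| := by rw [abs_mul]; norm_num
  have hadda := abs_add_le a b
  have hsuba := abs_sub a b
  have f1 := key a 0 (a * n) (by ring) (by rw [abs_zero]; omega) (lown a ha)
  have f2 := key b 0 (b * n) (by ring) (by rw [abs_zero]; omega) (lown b hb)
  have f3 := key 0 a (a * m) (by ring) (by rw [abs_zero]; omega) (lowm a ha)
  have f4 := key 0 b (b * m) (by ring) (by rw [abs_zero]; omega) (lowm b hb)
  have g1 := key (2 * a) 0 (2 * a * n) (by ring) (by rw [abs_zero, h2a]; omega)
    (lown _ (by omega))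
  have g2 := key (2 * b) 0 (2 * b * n) (by ring) (by rw [abs_zero, h2b]; omega)
    (lown _ (by omega))
  have g3 := key 0 (2 * a) (2 * a * m) (by ring) (by rw [abs_zero, h2a]; omega)
    (lowm _ (by omega))
  have g4 := key 0 (2 * b) (2 * b * m) (by ring) (by rw [abs_zero, h2b]; omega)
    (lowm _ (by omega))
  have g5 := key (a + b) 0 ((a + b) * n) (by ring) (by rw [abs_zero]; omega) (lown _ hadd)
  have g6 := key (a - b) 0 ((a - b) * n) (by ring) (by rw [abs_zero]; omega) (lown _ hsub)
  have g7 := key a a (a * (n + m)) (by ring) (by omega) (lownm a ha)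
  have g8 := key a (-a) (a * (n - m)) (by ring) (by rw [abs_neg]; omega)
    (le_abs_mul_sub hadd hm' hmM1 hmc1 (Or.inr (by rw [← h]; ring)))
  have g9 := key a (-b) (a * n - b * m) (by ring) (by rw [abs_neg]; omega)
    (le_abs_mul_sub (s := 2 * a) (by omega) hn' hnM1 hnc1 (Or.inl (by rw [← h]; ring)))
  have hsq : a ^ 2 - b ^ 2 ≠ 0 := by
    rw [sq_sub_sq]; exact mul_ne_zero hadd hsub
  have hsq' : -a ^ 2 - b ^ 2 ≠ 0 := by
    have := pow_pos (abs_pos.2 ha) 2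
    rw [sq_abs] at this
    nlinarith [sq_nonneg b]
  have hM2 : 2 * (|a| * M) ≤ (m : ℤ) := by nlinarith
  have hc2 : 2 * (|b| * |c|) ≤ (m : ℤ) := by nlinarith
  have g10 := key b a (b * n + a * m) (by ring) (by omega)
    (le_abs_of_mul_eq ha hsq hM2 hc2 (by rw [← h]; ring))
  have g11 := key b (-a) (b * n - a * m) (by ring) (by rw [abs_neg]; omega)
    (le_abs_of_mul_eq ha hsq' hM2 hc2 (by rw [← h]; ring))
  have g12 := key b b (b * (n + m)) (by ring) (by omega) (lownm b hb)
  have g13 := key b (-b) (b * (n - m)) (by ring) (by rw [abs_neg]; omega)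
    (le_abs_mul_sub hadd hn' hnM1 hnc1 (Or.inl (by rw [← h]; ring)))
  have g14 := key 0 (a + b) ((a + b) * m) (by ring) (by rw [abs_zero]; omega) (lowm _ hadd)
  have g15 := key 0 (a - b) ((a - b) * m) (by ring) (by rw [abs_zero]; omega) (lowm _ hsub)
  constructor
  · convert add_mem (add_mem f1 f2) (add_mem f3 f4) using 1
    funext x
    simp only [pairSum, twoCos_mul, Pi.add_apply]
    push_cast
    ring
  · have g16 := Submodule.smul_mem _ (1 / 2 : ℂ) (add_mem (add_mem (add_mem g1 g2) g3) g4)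
    convert add_mem (add_mem (add_mem (add_mem (add_mem (add_mem g16 (add_mem g5 g6))
      (add_mem g7 g8)) g9) (add_mem g10 g11)) (add_mem g12 g13)) (add_mem g14 g15) using 1
    funext x
    have := congrArg (fun y : ℝ => (y : ℂ)) (pairSum_sq h x)
    simp only [Pi.add_apply, Pi.smul_apply, smul_eq_mul]
    push_cast at this
    rw [this]
    ring

/-! ### The characteristic function of a block -/

/-- The characteristic function of the sum over a block of separated pairs `(n i, m i)` with
`a * n i + b * m i = c` is close to that of a variance mixture of Gaussian variables. -/
theorem norm_charFun_block_sub_le {a b : ℤ} (ha : a ≠ 0) (hb : b ≠ 0) (hab : |a| ≠ |b|) {c : ℤ}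
    (hc : c ≠ 0) {K D L : ℕ} (hD : (D : ℤ) = |a| + |b|) (hL : 8 * D ^ 2 * (K + 1) ≤ L)
    {n m : ℕ → ℕ} (hrel : ∀ i < K, a * n i + b * m i = c)
    (hnc : ∀ i < K, L * c.natAbs ≤ n i) (hmc : ∀ i < K, L * c.natAbs ≤ m i)
    (hsep : ∀ r < K, ∀ i < r, L * max (n i) (m i) ≤ min (n r) (m r))
    {l : ℝ} (hl : |l| ≤ 1 / 4) :
    ‖(∫ x in (0 : ℝ)..1, Complex.exp (Complex.I * (l * ∑ i ∈ Finset.range K,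
        pairSum a b (n i) (m i) x : ℝ)))
      - ∫ x in (0 : ℝ)..1, (Real.exp (-(K * l ^ 2 / 2 * (2 + cosChar 1 x))) : ℂ)‖
      ≤ 2 * (Real.exp (K * (64 * |l| ^ 3)) - 1) := by
  have ha1 := Int.one_le_abs ha
  have hb1 := Int.one_le_abs hb
  have hD2 : 2 ≤ D := by omega
  have hc1 : 1 ≤ c.natAbs := Int.natAbs_pos.2 hc
  have hL0 : 4 * D ≤ L := by nlinarith
  -- `V + Q i` is the Taylor polynomial `1 + ilX - l²X²/2` of `exp(ilX)`. `V` collects the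
  -- frequencies `0` and `± c`, common to all pairs, and `Q i` the high ones.
  set V : ℝ → ℂ := fun x => 1 - l ^ 2 / 2 * (2 + cosChar c x) with hV
  set Q : ℕ → ℝ → ℂ := fun i x => Complex.I * l * pairSum a b (n i) (m i) x
    - l ^ 2 / 2 * (pairSum a b (n i) (m i) x ^ 2 - (2 + cosChar c x)) with hQ
  have hn0 : ∀ i < K, L ≤ n i := fun i hi => by nlinarith [hnc i hi]
  have hm0 : ∀ i < K, L ≤ m i := fun i hi => by nlinarith [hmc i hi]
  have memQ : ∀ i < K, ∀ M e : ℕ, 2 * D * M ≤ min (n i) (m i) → 2 * D * max (n i) (m i) ≤ e →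
      Q i ∈ trigPoly (pairFreq M e) := by
    intro i hi M e hM he
    have hnn : 2 * D * c.natAbs ≤ n i :=
      (Nat.mul_le_mul_right _ (by omega)).trans (hnc i hi)
    have hmm : 2 * D * c.natAbs ≤ m i :=
      (Nat.mul_le_mul_right _ (by omega)).trans (hmc i hi)
    have hn1 : 2 * D * n i ≤ e := (Nat.mul_le_mul_left _ (le_max_left _ _)).trans he
    have hm1 : 2 * D * m i ≤ e := (Nat.mul_le_mul_left _ (le_max_right _ _)).trans he
    have hn2 : 2 * D * M ≤ n i := hM.trans (min_le_left _ _)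
    have hm2 : 2 * D * M ≤ m i := hM.trans (min_le_right _ _)
    have := pairSum_mem_trigPoly ha hb hab (M := M) (e := e) (n := n i) (m := m i)
      (by have := hn0 i hi; omega) (by have := hm0 i hi; omega) (hrel i hi)
      (by rw [← hD]; exact_mod_cast hn2) (by rw [← hD]; exact_mod_cast hm2)
      (by rw [← hD, ← Int.natCast_natAbs]; exact_mod_cast hnn)
      (by rw [← hD, ← Int.natCast_natAbs]; exact_mod_cast hmm)
      (by rw [← hD]; exact_mod_cast hn1) (by rw [← hD]; exact_mod_cast hm1)
    exact sub_mem (Submodule.smul_mem _ (Complex.I * l) this.1)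
      (Submodule.smul_mem _ ((l : ℂ) ^ 2 / 2) this.2)
  have memV : ∀ e : ℕ, c.natAbs ≤ e → V ∈ lowTrig e := by
    intro e he
    have h1 := Submodule.smul_mem _ (1 - (l : ℂ) ^ 2) (one_mem_lowTrig e)
    have h2 := Submodule.smul_mem _ ((l : ℂ) ^ 2 / 2) (cosChar_mem_lowTrig he)
    convert sub_mem h1 h2 using 1
    funext x
    simp only [hV, Pi.sub_apply, Pi.smul_apply, smul_eq_mul, Pi.one_apply]
    ring
  have main : ∫ x in (0 : ℝ)..1, ∏ i ∈ Finset.range K, (V x + Q i x) =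
      ∫ x in (0 : ℝ)..1, V x ^ K := by
    have hμ : ∀ r < K, c.natAbs ≤ min (n r) (m r) / L := fun r hr => by
      rw [Nat.le_div_iff_mul_le (by omega), mul_comm]
      exact le_min (hnc r hr) (hmc r hr)
    have hdc : ∀ r < K, c.natAbs ≤ 2 * D * (min (n r) (m r) / L) := fun r hr => by
      have := hμ r hr
      nlinarith
    -- With `μ = min (n r) (m r)`, separation bounds the earlier degrees by `2D(μ / L)`, while `Q r`
    -- has frequencies of size at least `μ / (2D)`. The lower bound on `L` makes the latter exceed
    -- `K` times the former.
    refine integral_prod_add_eq (d := fun r => 2 * D * (min (n r) (m r) / L))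
      (M := fun r => min (n r) (m r) / (2 * D)) (fun r hr => memV _ (hdc r hr)) ?_ ?_ ?_
    · intro r hr i hi
      refine add_mem (memV _ (hdc r hr)) (trigPoly_mono (fun w hw => hw.2)
        (memQ i (hi.trans hr) 0 _ (by simp) (Nat.mul_le_mul_left _ ?_)))
      rw [Nat.le_div_iff_mul_le (by omega), mul_comm]
      exact hsep r hr i hi
    · intro r hr
      exact trigPoly_mono (fun w hw => hw.1)
        (memQ r hr _ (2 * D * max (n r) (m r)) (Nat.mul_div_le _ _) le_rfl)
    · intro r hr
      have h1 := hμ r hr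
      have h2 := Nat.div_mul_le_self (min (n r) (m r)) L
      set t := min (n r) (m r) / L
      have h3 : 8 * D ^ 2 * (K + 1) * t ≤ min (n r) (m r) :=
        (Nat.mul_le_mul_right _ hL).trans (by rw [mul_comm]; exact h2)
      change _ < min (n r) (m r) / (2 * D)
      rw [Nat.lt_iff_add_one_le, Nat.le_div_iff_mul_le (by omega)]
      refine le_trans ?_ h3
      have ht : 1 ≤ t := hc1.trans h1
      have h4 : D ≤ D ^ 2 * t := by nlinarith
      nlinarith [Nat.zero_le (D ^ 2 * K * t)]
  have hVc : Continuous V := continuous_of_mem_trigPoly (memV _ le_rfl)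
  have hQc : ∀ i < K, Continuous (Q i) := fun i hi =>
    continuous_of_mem_trigPoly (memQ i hi 0 _ (by simp) le_rfl)
  have hXc : ∀ i, Continuous (pairSum a b (n i) (m i)) := fun i => continuous_pairSum _ _ _ _
  have hcc := continuous_cosChar c
  have hl0 := abs_nonneg l
  have first : ‖(∫ x in (0 : ℝ)..1, Complex.exp (Complex.I * (l * ∑ i ∈ Finset.range K,
        pairSum a b (n i) (m i) x : ℝ))) -
      ∫ x in (0 : ℝ)..1, ∏ i ∈ Finset.range K, (V x + Q i x)‖
      ≤ Real.exp (K * (64 * |l| ^ 3)) - 1 := by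
    rw [← intervalIntegral.integral_sub]
    · refine (intervalIntegral.norm_integral_le_of_norm_le_const
        (C := Real.exp (K * (64 * |l| ^ 3)) - 1) fun x _ => ?_).trans (by simp)
      rw [norm_sub_rev]
      have : Complex.exp (Complex.I * (l * ∑ i ∈ Finset.range K, pairSum a b (n i) (m i) x : ℝ))
          = ∏ i ∈ Finset.range K, Complex.exp (Complex.I * (l * pairSum a b (n i) (m i) x : ℝ)) := by
        rw [← Complex.exp_sum, ← Finset.mul_sum]
        push_cast
        rw [← Finset.mul_sum]
      rw [this]
      have hnorm : ∀ y : ℝ, ‖Complex.exp (Complex.I * y)‖ = 1 := fun y => by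
        rw [mul_comm, Complex.norm_exp_ofReal_mul_I]
      refine norm_prod_sub_prod_le (fun i _ => Complex.exp_ne_zero _) (fun i _ => (hnorm _).le)
        fun i _ => ?_
      rw [hnorm, mul_one]
      have hX := abs_pairSum_le a b (n i) (m i) x
      have hlX : |l * pairSum a b (n i) (m i) x| ≤ |l| * 4 := by
        rw [abs_mul]
        exact mul_le_mul_of_nonneg_left hX hl0
      have h1 := norm_taylor_exp_mul_I_sub_le (hlX.trans (by linarith))
      refine le_trans (le_of_eq ?_) (h1.trans ?_)
      · congr 2
        simp only [hV, hQ]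
        push_cast
        ring
      · calc _ ≤ (|l| * 4) ^ 3 := pow_le_pow_left₀ (abs_nonneg _) hlX 3
          _ = _ := by ring
    · apply Continuous.intervalIntegrable
      fun_prop
    · apply Continuous.intervalIntegrable
      refine continuous_finsetProd _ fun i hi => hVc.add (hQc i (Finset.mem_range.1 hi))
  have second : ‖(∫ x in (0 : ℝ)..1, V x ^ K) -
      ∫ x in (0 : ℝ)..1, (Real.exp (-(K * l ^ 2 / 2 * (2 + cosChar c x))) : ℂ)‖
      ≤ Real.exp (K * (64 * |l| ^ 3)) - 1 := by
    rw [← intervalIntegral.integral_sub]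
    · refine (intervalIntegral.norm_integral_le_of_norm_le_const
        (C := Real.exp (K * (64 * |l| ^ 3)) - 1) fun x _ => ?_).trans (by simp)
      set y := l ^ 2 / 2 * (2 + cosChar c x) with hy
      have hcos : |cosChar c x| ≤ 1 := Real.abs_cos_le_one _
      rw [abs_le] at hcos
      have hl2 : l ^ 2 ≤ 1 / 16 := by rw [← sq_abs]; nlinarith
      have hy0 : 0 ≤ y := mul_nonneg (by positivity) (by linarith)
      have hy1 : y ≤ 3 / 2 * l ^ 2 := by nlinarith [sq_nonneg l]
      have e1 : (Real.exp (-(K * l ^ 2 / 2 * (2 + cosChar c x))) : ℂ)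
          = ∏ i ∈ Finset.range K, (Real.exp (-y) : ℂ) := by
        rw [Finset.prod_const, Finset.card_range, ← Complex.ofReal_pow, ← Real.exp_nat_mul]
        congr 2
        rw [hy]; ring
      have e2 : V x ^ K = ∏ i ∈ Finset.range K, ((1 - y : ℝ) : ℂ) := by
        rw [Finset.prod_const, Finset.card_range]
        simp only [hV, hy]
        push_cast
        rfl
      rw [e1, e2]
      refine norm_prod_sub_prod_le (fun i _ => by exact_mod_cast (Real.exp_pos _).ne')
        (fun i _ => ?_) fun i _ => ?_
      · rw [Complex.norm_real, Real.norm_eq_abs, abs_of_pos (Real.exp_pos _), Real.exp_le_one_iff]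
        linarith
      · rw [← Complex.ofReal_sub, Complex.norm_real, Complex.norm_real, Real.norm_eq_abs,
          Real.norm_eq_abs, abs_of_pos (Real.exp_pos _)]
        refine (abs_one_sub_sub_exp_neg_le hy0 (by linarith)).trans
          (mul_le_mul_of_nonneg_right ?_ (Real.exp_pos _).le)
        have h1 : y ^ 2 ≤ (3 / 2 * l ^ 2) ^ 2 := pow_le_pow_left₀ hy0 hy1 2
        have h2 : l ^ 2 = |l| ^ 2 := (sq_abs l).symm
        rw [h2] at h1
        have h3 : |l| ^ 4 ≤ |l| ^ 3 := pow_le_pow_of_le_one hl0 (by linarith) (by norm_num)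
        nlinarith [pow_nonneg hl0 3]
    · exact (hVc.pow K).intervalIntegrable _ _
    · apply Continuous.intervalIntegrable
      fun_prop
  have third : ∫ x in (0 : ℝ)..1, (Real.exp (-(K * l ^ 2 / 2 * (2 + cosChar c x))) : ℂ)
      = ∫ x in (0 : ℝ)..1, (Real.exp (-(K * l ^ 2 / 2 * (2 + cosChar 1 x))) : ℂ) :=
    integral_comp_cosChar (G := fun u => (Real.exp (-(K * l ^ 2 / 2 * (2 + u))) : ℂ))
      (by fun_prop) hc
  rw [main] at first
  rw [← third, ← sub_add_sub_cancel]
  exact (norm_add_le _ _).trans (by linarith)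

/-! ### Lacunarity and separated solutions of the linear equation -/

theorem HadamardLacunary.strictMono {n : ℕ → ℕ} (hpos : ∀ k, 0 < n k)
    (hgap : HadamardLacunary n) : StrictMono n := by
  obtain ⟨q, hq, h⟩ := hgap
  refine strictMono_nat_of_lt_succ fun k => ?_
  have h0 : (0 : ℝ) < n k := by exact_mod_cast hpos k
  have := (le_div_iff₀ h0).1 (h k)
  have : (n k : ℝ) < n (k + 1) := by nlinarith
  exact_mod_cast this

theorem HadamardLacunary.exists_mul_le {n : ℕ → ℕ} (hpos : ∀ k, 0 < n k)
    (hgap : HadamardLacunary n) (R : ℕ) : ∃ G : ℕ, ∀ m m', m + G ≤ m' → R * n m ≤ n m' := by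
  have hmono := hgap.strictMono hpos
  obtain ⟨q, hq, h⟩ := hgap
  obtain ⟨G, hG⟩ := pow_unbounded_of_one_lt (R : ℝ) hq
  refine ⟨G, fun m m' hm => ?_⟩
  have key : ∀ g, q ^ g * n m ≤ (n (m + g) : ℝ) := by
    intro g
    induction g with
    | zero => simp
    | succ g ih =>
      have h0 : (0 : ℝ) < n (m + g) := by exact_mod_cast hpos _
      have := (le_div_iff₀ h0).1 (h (m + g))
      rw [← add_assoc, pow_succ]
      nlinarith
  have h1 : ((R * n m : ℕ) : ℝ) ≤ n (m + G) := by
    push_cast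
    exact (mul_le_mul_of_nonneg_right hG.le (Nat.cast_nonneg _)).trans (key G)
  exact (Nat.cast_le.1 h1).trans (hmono.monotone hm)

/-- The pairs solving `a * n k + b * n l = c`. -/
def solutionSet (n : ℕ → ℕ) (a b c : ℤ) : Set (ℕ × ℕ) :=
  {p : ℕ × ℕ | a * (n p.1 : ℤ) + b * (n p.2 : ℤ) = c}

section Solutions

variable {n : ℕ → ℕ} {a b c : ℤ}

theorem injOn_fst_solutionSet (hmono : StrictMono n) (hb : b ≠ 0) :
    Set.InjOn Prod.fst (solutionSet n a b c) := by
  rintro ⟨k, l⟩ h ⟨k', l'⟩ h' (rfl : k = k')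
  simp only [solutionSet, Set.mem_ofPred_eq] at h h'
  have h1 : b * (n l : ℤ) = b * n l' := by linarith
  have h2 : n l = n l' := by exact_mod_cast mul_left_cancel₀ hb h1
  rw [hmono.injective h2]

theorem injOn_snd_solutionSet (hmono : StrictMono n) (ha : a ≠ 0) :
    Set.InjOn Prod.snd (solutionSet n a b c) := by
  rintro ⟨k, l⟩ h ⟨k', l'⟩ h' (rfl : l = l')
  simp only [solutionSet, Set.mem_ofPred_eq] at h h'
  have h1 : a * (n k : ℤ) = a * n k' := by linarith
  have h2 : n k = n k' := by exact_mod_cast mul_left_cancel₀ ha h1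
  rw [hmono.injective h2]

/-- Each coordinate of a solution determines the other. -/
theorem encard_solutionSet_le (hmono : StrictMono n) (ha : a ≠ 0) (hb : b ≠ 0) {A B : Finset ℕ}
    (h : ∀ p ∈ solutionSet n a b c, p.1 ∈ A ∨ p.2 ∈ B) :
    (solutionSet n a b c).encard ≤ (A.card + B.card : ℕ) := by
  set S := solutionSet n a b c
  have hS : S ⊆ {p ∈ S | p.1 ∈ A} ∪ {p ∈ S | p.2 ∈ B} := fun p hp =>
    (h p hp).imp (fun h1 => ⟨hp, h1⟩) fun h1 => ⟨hp, h1⟩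
  have h1 : {p ∈ S | p.1 ∈ A}.encard ≤ (A : Set ℕ).encard :=
    Set.encard_le_encard_of_injOn (f := Prod.fst) (fun p hp => hp.2)
      ((injOn_fst_solutionSet hmono hb).mono fun p hp => hp.1)
  have h2 : {p ∈ S | p.2 ∈ B}.encard ≤ (B : Set ℕ).encard :=
    Set.encard_le_encard_of_injOn (f := Prod.snd) (fun p hp => hp.2)
      ((injOn_snd_solutionSet hmono ha).mono fun p hp => hp.1)
  rw [Set.encard_coe_eq_coe_finsetCard] at h1 h2
  push_cast
  exact (Set.encard_le_encard hS).trans ((Set.encard_union_le _ _).trans (add_le_add h1 h2))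

theorem abs_mul_le_of_eq {x y : ℕ} (h : a * (x : ℤ) + b * (y : ℤ) = c) :
    |a| * x ≤ |b| * y + |c| := by
  have h1 : a * (x : ℤ) = c - b * y := by linarith
  have h2 := abs_sub c (b * y)
  rw [← h1, abs_mul, abs_mul, Nat.abs_cast, Nat.abs_cast] at h2
  linarith

theorem abs_le_of_eq {x y : ℕ} (h : a * (x : ℤ) + b * (y : ℤ) = c) :
    |c| ≤ |a| * x + |b| * y := by
  have h2 := abs_add_le (a * (x : ℤ)) (b * y)
  rwa [h, abs_mul, abs_mul, Nat.abs_cast, Nat.abs_cast] at h2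

/-- In a solution with `n k` below the order of magnitude of `c`, one of the two indices is close
to the index `Z` at which `n` reaches `c`. -/
theorem mem_Icc_of_solution {D R G Z k l : ℕ} (ha : a ≠ 0) (hb : b ≠ 0)
    (hD : (D : ℤ) = |a| + |b|) (hR : 4 * D ≤ R)
    (hG : ∀ m m', m + G ≤ m' → R * n m ≤ n m') (hZ : c.natAbs ≤ n Z)
    (hZ' : ∀ m < Z, n m < c.natAbs) (h : a * (n k : ℤ) + b * (n l : ℤ) = c)
    (hk : k < Z + G) (hkI : k ∉ Finset.Icc (Z - G - 1) (Z + G)) :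
    l ∈ Finset.Icc (Z - G - 1) (Z + G) := by
  have ha1 := Int.one_le_abs ha
  have hb1 := Int.one_le_abs hb
  simp only [Finset.mem_Icc, not_and_or, not_le] at hkI ⊢
  have low : ∀ m, m < Z - G - 1 → (R : ℤ) * n m < |c| := fun m hm => by
    have h1 := hG m (Z - 1) (by omega)
    have h2 := hZ' (Z - 1) (by omega)
    rw [← Int.natCast_natAbs]
    exact_mod_cast h1.trans_lt h2
  have hk2 := low k (by omega)
  have hR' : (4 : ℤ) * (|a| + |b|) ≤ R := by rw [← hD]; exact_mod_cast hR
  have hnk : (0 : ℤ) ≤ n k := by positivity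
  have hnl : (0 : ℤ) ≤ n l := by positivity
  have e1 : 4 * (|a| * n k) ≤ R * (n k : ℤ) := by nlinarith
  constructor
  · by_contra hl
    have hl2 := low l (by omega)
    have e2 : 4 * (|b| * n l) ≤ R * (n l : ℤ) := by nlinarith
    have := abs_le_of_eq h
    linarith [abs_nonneg c]
  · by_contra hl
    have h1 := hG Z l (by omega)
    have h2 : (R : ℤ) * |c| ≤ n l := by
      rw [← Int.natCast_natAbs]
      exact_mod_cast (Nat.mul_le_mul_left R hZ).trans h1
    have h3 := abs_mul_le_of_eq (a := b) (b := a) (c := c) (x := n l) (y := n k) (by rw [← h]; ring)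
    have hc := abs_nonneg c
    have hc0 : 0 < |c| := lt_of_le_of_lt (by positivity) hk2
    nlinarith

/-- All but a bounded number of solutions have both indices beyond `T` and beyond the place where
`n` reaches a large multiple of `c`. There the two indices of a solution differ by a bounded amount,
so taking every `W`-th first index separates whole pairs. -/
theorem exists_separated_solutions (hpos : ∀ k, 0 < n k) (hgap : HadamardLacunary n) (ha : a ≠ 0)
    (hb : b ≠ 0) (hinf : ∀ K : ℕ, ∃ c : ℤ, c ≠ 0 ∧ (K : ℕ∞) < (solutionSet n a b c).encard)
    (K G L T : ℕ) : ∃ c : ℤ, c ≠ 0 ∧ ∃ k l : ℕ → ℕ,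
      (∀ i < K, a * (n (k i) : ℤ) + b * (n (l i) : ℤ) = c ∧ T ≤ k i ∧ T ≤ l i ∧
        L * c.natAbs ≤ n (k i) ∧ L * c.natAbs ≤ n (l i)) ∧
      ∀ i' < K, ∀ i < i', max (k i) (l i) + G ≤ min (k i') (l i') := by
  classical
  have hmono := hgap.strictMono hpos
  have ha1 := Int.one_le_abs ha
  have hb1 := Int.one_le_abs hb
  obtain ⟨D, hD⟩ : ∃ D : ℕ, (D : ℤ) = |a| + |b| := ⟨a.natAbs + b.natAbs, by simp⟩
  obtain ⟨H, hH⟩ := hgap.exists_mul_le hpos (4 * D * (L + 1))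
  have hR4 : 4 * D ≤ 4 * D * (L + 1) := Nat.le_mul_of_pos_right _ (by omega)
  have hRL : L + 1 ≤ 4 * D * (L + 1) := Nat.le_mul_of_pos_left _ (by omega)
  set R := 4 * D * (L + 1)
  -- Each second index strays by at most `H` from its first index, so `2 * H + G` secures a gap `G`
  -- between pairs. The `1` keeps `W` positive.
  set W := 2 * H + G + 1 with hW
  -- Besides the `K * W` solutions wanted, allow for those with a coordinate in the window around
  -- `Z`, of at most `2 * H + 2` indices, or below `T`. Either coordinate may be the bad one, whence
  -- the factor two.
  obtain ⟨c, hc, hcard⟩ := hinf (K * W + 2 * (2 * H + 2 + T))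
  have hex : ∃ Z, c.natAbs ≤ n Z := ⟨c.natAbs, hmono.id_le _⟩
  set Z := Nat.find hex
  have hZ : c.natAbs ≤ n Z := Nat.find_spec hex
  have hZ' : ∀ m < Z, n m < c.natAbs := fun m hm => not_le.1 (Nat.find_min hex hm)
  have hbig : ∀ m, Z + H ≤ m → (L + 1) * c.natAbs ≤ n m := fun m hm =>
    (Nat.mul_le_mul hRL hZ).trans (hH Z m hm)
  set A : ℕ → Prop := fun k => ∃ l, (k, l) ∈ solutionSet n a b c ∧ Z + H ≤ k ∧ Z + H ≤ l ∧
    T ≤ k ∧ T ≤ l with hA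
  have hAcard : ∀ hf : (Set.ofPred A).Finite, K * W ≤ hf.toFinset.card := by
    intro hf
    by_contra hlt
    push Not at hlt
    set I := Finset.Icc (Z - H - 1) (Z + H)
    have hI : I.card ≤ 2 * H + 2 := by
      simp only [I, Nat.card_Icc]
      omega
    have hle := encard_solutionSet_le (c := c) hmono ha hb
      (A := hf.toFinset ∪ I ∪ Finset.range T) (B := I ∪ Finset.range T) ?_
    · have h1 := Finset.card_union_le (hf.toFinset ∪ I) (Finset.range T)
      have h2 := Finset.card_union_le hf.toFinset I
      have h3 := Finset.card_union_le I (Finset.range T)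
      rw [Finset.card_range] at h1 h3
      have h4 := hcard.trans_le hle
      rw [Nat.cast_lt] at h4
      omega
    · rintro ⟨k, l⟩ hp
      simp only [Finset.mem_union, Set.Finite.mem_toFinset, Finset.mem_range]
      by_contra hno
      push Not at hno
      obtain ⟨⟨⟨hkA, hkI⟩, hkT⟩, hlI, hlT⟩ := hno
      have hp' : a * (n k : ℤ) + b * (n l : ℤ) = c := hp
      by_cases hk : k < Z + H
      · exact hlI (mem_Icc_of_solution ha hb hD hR4 hH hZ hZ' hp' hk hkI)
      by_cases hl : l < Z + H
      · exact hkI (mem_Icc_of_solution hb ha (by rw [hD]; ring) hR4 hH hZ hZ'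
          (by rw [← hp']; ring) hl hlI)
      exact hkA ⟨l, hp, not_lt.1 hk, not_lt.1 hl, hkT, hlT⟩
  -- `Nat.nth` takes the default value `0` past the end of a finite set, so the positions used must
  -- stay below its cardinality.
  have hlt : ∀ i < K, ∀ hf : (Set.ofPred A).Finite, i * W < hf.toFinset.card := fun i hi hf =>
    lt_of_lt_of_le (Nat.mul_lt_mul_of_pos_right hi (by omega)) (hAcard hf)
  set k : ℕ → ℕ := fun i => Nat.nth A (i * W) with hk
  have hkA : ∀ i < K, A (k i) := fun i hi => Nat.nth_mem _ (hlt i hi)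
  have hex2 : ∀ i, ∃ l, i < K → (k i, l) ∈ solutionSet n a b c ∧ Z + H ≤ k i ∧ Z + H ≤ l ∧
      T ≤ k i ∧ T ≤ l := fun i => by
    by_cases hi : i < K
    · obtain ⟨l, hl⟩ := hkA i hi
      exact ⟨l, fun _ => hl⟩
    · exact ⟨0, fun h => absurd h hi⟩
  choose l hl using hex2
  -- Were `x` beyond `y + H`, then `n x` would be at least `4 * D * n y`, whereas the equation and
  -- `|c| ≤ n y` give `n x ≤ |b| * n y + |c| ≤ D * n y`.
  have hcc : ∀ {x y : ℕ} {a b : ℤ}, 1 ≤ |a| → |b| < D → a * (n x : ℤ) + b * (n y : ℤ) = c →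
      Z + H ≤ y → x ≤ y + H := by
    intro x y a b ha hb h hy
    by_contra hxy
    have h1 := hH y x (by omega)
    have h2 := (Nat.mul_le_mul_right (n y) hR4).trans h1
    have h3 := abs_mul_le_of_eq h
    have h4 := hbig y hy
    have h5 : |c| ≤ n y := by
      rw [← Int.natCast_natAbs]
      have : c.natAbs ≤ (L + 1) * c.natAbs := Nat.le_mul_of_pos_left _ (by omega)
      exact_mod_cast this.trans h4
    have h6 : (4 * D * n y : ℤ) ≤ n x := by exact_mod_cast h2
    have h7 : (0 : ℤ) < n y := by exact_mod_cast hpos y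
    nlinarith
  have hclose : ∀ i < K, k i ≤ l i + H ∧ l i ≤ k i + H := fun i hi => by
    obtain ⟨h1, h2, h3, -⟩ := hl i hi
    have h1' : a * (n (k i) : ℤ) + b * (n (l i) : ℤ) = c := h1
    exact ⟨hcc ha1 (by omega) h1' h3, hcc (b := a) hb1 (by omega) (by rw [← h1']; ring) h2⟩
  have hstep : ∀ i' < K, ∀ i < i', k i + W ≤ k i' := by
    intro i' hi' i hii
    have hind : ∀ t, t ≤ (i' - i) * W → k i + t ≤ Nat.nth A (i * W + t) := by
      intro t
      induction t with
      | zero => intro _; simp [hk]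
      | succ t ih =>
        intro ht
        have h1 := ih (by omega)
        have h2 : i * W + (t + 1) ≤ i' * W := by
          have : i' * W = i * W + (i' - i) * W := by
            rw [← add_mul]; congr 1; omega
          omega
        have h3 : Nat.nth A (i * W + t) < Nat.nth A (i * W + (t + 1)) :=
          Nat.nth_lt_nth' (by omega) fun hf => h2.trans_lt (hlt i' hi' hf)
        omega
    have h1 := hind ((i' - i) * W) le_rfl
    rw [← add_mul, show i + (i' - i) = i' by omega] at h1
    have h2 : W ≤ (i' - i) * W := Nat.le_mul_of_pos_left _ (by omega)
    exact (Nat.add_le_add_left h2 _).trans h1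
  refine ⟨c, hc, k, l, fun i hi => ?_, fun i' hi' i hii => ?_⟩
  · obtain ⟨h1, h2, h3, h4, h5⟩ := hl i hi
    have hL : L * c.natAbs ≤ (L + 1) * c.natAbs := Nat.mul_le_mul_right _ (by omega)
    exact ⟨h1, h4, h5, hL.trans (hbig _ h2), hL.trans (hbig _ h3)⟩
  · have h1 := hclose i (hii.trans hi')
    have h2 := hclose i' hi'
    have h3 := hstep i' hi' i hii
    omega

end Solutions

/-- A sequence that violates `B₂` has arbitrarily long separated blocks of solutions of
`a * n k + b * n l = c`, for some `a`, `b` of different absolute value. -/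
theorem exists_blocks {n : ℕ → ℕ} (hpos : ∀ k, 0 < n k) (hgap : HadamardLacunary n)
    (hB2 : ¬ ConditionB2 n) : ∃ a b : ℤ, a ≠ 0 ∧ b ≠ 0 ∧ |a| ≠ |b| ∧ ∀ K G L T : ℕ,
      ∃ c : ℤ, c ≠ 0 ∧ ∃ k l : ℕ → ℕ,
      (∀ i < K, a * (n (k i) : ℤ) + b * (n (l i) : ℤ) = c ∧ T ≤ k i ∧ T ≤ l i ∧
        L * c.natAbs ≤ n (k i) ∧ L * c.natAbs ≤ n (l i)) ∧
      ∀ i' < K, ∀ i < i', max (k i) (l i) + G ≤ min (k i') (l i') := by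
  have hmono := hgap.strictMono hpos
  simp only [ConditionB2] at hB2
  push Not at hB2
  obtain ⟨a, b, ha, hb, hinf⟩ := hB2
  have hblock := exists_separated_solutions hpos hgap ha hb hinf
  refine ⟨a, b, ha, hb, fun hab => ?_, hblock⟩
  obtain ⟨q, hq, hqn⟩ := hgap
  -- If `|a| = |b|`, then `c` is a multiple of the sum or the difference of the two terms. For `u <
  -- v` the gap condition gives `n v - n u ≥ (1 - 1/q) * n v`, which exceeds `|c|` once `n v ≥ (L +
  -- 1) * |c|` with this `L`. A single solution is thus contradictory.
  obtain ⟨L, hL⟩ := exists_nat_gt (q / (q - 1))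
  obtain ⟨c, hc, k, l, h, -⟩ := hblock 1 0 (L + 1) 0
  obtain ⟨hrel, -, -, hk, hl⟩ := h 0 one_pos
  set x := k 0
  set y := l 0
  have ha1 := Int.one_le_abs ha
  have hc1 : 1 ≤ |c| := Int.one_le_abs hc
  have hcn : (c.natAbs : ℤ) = |c| := Int.natCast_natAbs c
  have hk' : (L + 1 : ℤ) * |c| ≤ n x := by rw [← hcn]; exact_mod_cast hk
  have hl' : (L + 1 : ℤ) * |c| ≤ n y := by rw [← hcn]; exact_mod_cast hl
  have hx0 : (0 : ℤ) < n x := by exact_mod_cast hpos x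
  have hy0 : (0 : ℤ) < n y := by exact_mod_cast hpos y
  have hq1 : 0 < q - 1 := by linarith
  have hdiff : ∀ u v : ℕ, u < v → (L + 1 : ℤ) * |c| ≤ n v → ¬ ((n v : ℤ) - n u ≤ |c|) := by
    intro u v huv hv hle
    have h1 : q * n u ≤ n v := by
      have h0 : (0 : ℝ) < n u := by exact_mod_cast hpos u
      have h2 : (n (u + 1) : ℝ) ≤ n v := by exact_mod_cast hmono.monotone huv
      exact ((le_div_iff₀ h0).1 (hqn u)).trans h2
    have h2 : ((L : ℝ) + 1) * |(c : ℝ)| ≤ n v := by exact_mod_cast hv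
    have h3 : (n v : ℝ) - n u ≤ |(c : ℝ)| := by exact_mod_cast hle
    have h4 : 1 ≤ |(c : ℝ)| := by exact_mod_cast hc1
    have h5 : q < L * (q - 1) := by rwa [div_lt_iff₀ hq1] at hL
    nlinarith
  rcases abs_eq_abs.1 hab with h | h
  · have h1 : |c| = |a| * (n x + n y) := by
      rw [← hrel, ← h, ← mul_add, abs_mul, abs_of_pos (by omega : (0 : ℤ) < n x + n y)]
    nlinarith
  · have h1 : |c| = |a| * |(n x : ℤ) - n y| := by
      rw [← hrel, show b = -a by omega, ← abs_mul]
      congr 1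
      ring
    have h2 : |(n x : ℤ) - n y| ≤ |c| := by
      rw [h1]; exact le_mul_of_one_le_left (abs_nonneg _) ha1
    rw [abs_le] at h2
    rcases lt_trichotomy x y with hxy | hxy | hxy
    · exact hdiff x y hxy hl' (by omega)
    · rw [hxy, sub_self, abs_zero, mul_zero] at h1
      omega
    · exact hdiff y x hxy hk' (by omega)

/-! ### Concatenation of blocks -/

theorem exists_block_index {O : ℕ → ℕ} (hO : StrictMono O) (h0 : O 0 = 0) (p : ℕ) :
    ∃ j, O j ≤ p ∧ p < O (j + 1) := by
  classical
  have hex : ∃ j, p < O (j + 1) := ⟨p, (Nat.lt_succ_self p).trans_le (hO.id_le _)⟩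
  refine ⟨Nat.find hex, ?_, Nat.find_spec hex⟩
  by_cases hj : Nat.find hex = 0
  · rw [hj, h0]; exact Nat.zero_le _
  · obtain ⟨j, hj'⟩ := Nat.exists_eq_succ_of_ne_zero hj
    rw [hj']
    exact not_lt.1 (Nat.find_min hex (by omega))

/-- Concatenation of separated blocks into one separated sequence of pairs. -/
theorem exists_pair_sequence {P : ℤ → ℕ → ℕ → ℕ → Prop}
    (hP : ∀ K G L T : ℕ, ∃ c : ℤ, c ≠ 0 ∧ ∃ k l : ℕ → ℕ,
      (∀ i < K, P c L (k i) (l i) ∧ T ≤ k i ∧ T ≤ l i) ∧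
      ∀ i' < K, ∀ i < i', max (k i) (l i) + G ≤ min (k i') (l i'))
    {O : ℕ → ℕ} (hO : StrictMono O) (h0 : O 0 = 0) (G₀ : ℕ) (G L : ℕ → ℕ) :
    ∃ k l : ℕ → ℕ, (∀ p p', p < p' → max (k p) (l p) + G₀ ≤ min (k p') (l p')) ∧
      ∀ j, ∃ c : ℤ, c ≠ 0 ∧ (∀ p, O j ≤ p → p < O (j + 1) → P c (L j) (k p) (l p)) ∧
        ∀ p p', O j ≤ p → p' < O (j + 1) → p < p' →
          max (k p) (l p) + G j ≤ min (k p') (l p') := by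
  choose c hc k l h1 h2 using fun j T => hP (O (j + 1) - O j) (G j + G₀) (L j) T
  -- `T j` is a starting threshold for block `j`. Adding the sum of all indices of a block passes
  -- every one of them, and `G₀` keeps the gap to the next block.
  let T : ℕ → ℕ := fun j => Nat.rec 0
    (fun j t => t + (∑ i ∈ Finset.range (O (j + 1) - O j), (k j t i + l j t i)) + G₀) j
  have hT : ∀ j, T (j + 1) =
      T j + (∑ i ∈ Finset.range (O (j + 1) - O j), (k j (T j) i + l j (T j) i)) + G₀ :=
    fun _ => rfl
  have hTmono : Monotone T := monotone_nat_of_le_succ fun j => by rw [hT]; omega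
  have hTb : ∀ j, ∀ i < O (j + 1) - O j, max (k j (T j) i) (l j (T j) i) + G₀ ≤ T (j + 1) := by
    intro j i hi
    rw [hT]
    have := Finset.single_le_sum (f := fun i => k j (T j) i + l j (T j) i)
      (fun _ _ => Nat.zero_le _) (Finset.mem_range.2 hi)
    omega
  choose J hJ1 hJ2 using exists_block_index hO h0
  have hJu : ∀ p j, O j ≤ p → p < O (j + 1) → J p = j := by
    intro p j hj hj'
    have e1 := hO.lt_iff_lt.1 (hj.trans_lt (hJ2 p))
    have e2 := hO.lt_iff_lt.1 ((hJ1 p).trans_lt hj')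
    omega
  have hin : ∀ p p' j, O j ≤ p → p' < O (j + 1) → p < p' →
      max (k j (T j) (p - O j)) (l j (T j) (p - O j)) + (G j + G₀)
        ≤ min (k j (T j) (p' - O j)) (l j (T j) (p' - O j)) := fun p p' j h3 h4 h5 =>
    h2 j (T j) (p' - O j) (by omega) (p - O j) (by omega)
  refine ⟨fun p => k (J p) (T (J p)) (p - O (J p)), fun p => l (J p) (T (J p)) (p - O (J p)),
    fun p p' hp => ?_, fun j => ⟨c j (T j), hc j _, fun p h3 h4 => ?_, fun p p' h3 h4 h5 => ?_⟩⟩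
  · have hJ1p := hJ1 p
    have hJ2p := hJ2 p
    have hJ1p' := hJ1 p'
    have hJ2p' := hJ2 p'
    have hle : J p ≤ J p' := by
      have := hO.lt_iff_lt.1 ((hJ1p.trans_lt hp).trans hJ2p')
      omega
    rcases hle.eq_or_lt with he | hlt
    · have h6 := hin p p' (J p) hJ1p (by rw [he]; exact hJ2p') hp
      beta_reduce
      rw [← he]
      omega
    · have h6 := hTb (J p) (p - O (J p)) (by omega)
      have h7 := hTmono (show J p + 1 ≤ J p' from hlt)
      obtain ⟨-, h8, h9⟩ := h1 (J p') (T (J p')) (p' - O (J p')) (by omega)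
      exact h6.trans (h7.trans (le_min h8 h9))
  · simp only [hJu p j h3 h4]
    exact (h1 j (T j) (p - O j) (by omega)).1
  · simp only [hJu p j h3 (by omega), hJu p' j (by omega) h4]
    have := hin p p' j h3 h4 h5
    omega

/-! ### Extension of the list of pairs to a permutation -/

theorem count_add_count_not (q : ℕ → Prop) [DecidablePred q] (N : ℕ) :
    Nat.count q N + Nat.count (fun m => ¬ q m) N = N := by
  induction N with
  | zero => simp
  | succ N ih =>
    rw [Nat.count_succ, Nat.count_succ]
    by_cases h : q N <;> simp [h] <;> omega

/-- An injective sequence with infinite complement extends to a permutation, in which the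
remaining numbers occupy a sparse set of positions. -/
theorem exists_perm_of_injective {s : ℕ → ℕ} (hs : Function.Injective s)
    (hinf : {m | m ∉ Set.range s}.Infinite) :
    ∃ (σ : Equiv.Perm ℕ) (M : ℕ → ℕ), (∀ N, M N ≤ N) ∧ (∀ N, N ≤ M N + (Nat.log 2 N + 1)) ∧
      Function.Surjective M ∧ ∀ (g : ℕ → ℝ) (C : ℝ), (∀ i, |g i| ≤ C) → ∀ N,
        |∑ k ∈ Finset.range N, g (σ k) - ∑ i ∈ Finset.range (M N), g (s i)|
          ≤ ((N : ℝ) - M N) * C := by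
  classical
  -- Positions that are not powers of two receive `s` in order, and the powers of two receive the
  -- numbers missed by `s`. Only logarithmically many terms among the first `N` are foreign.
  set q : ℕ → Prop := fun N => ¬ ∃ i, N = 2 ^ i with hq
  set c : ℕ → ℕ := Nat.nth fun m => m ∉ Set.range s with hc
  have hcmem : ∀ i, c i ∉ Set.range s := fun i => Nat.nth_mem_of_infinite hinf i
  have hcinj : Function.Injective c := Nat.nth_injective hinf
  have hqinf : (Set.ofPred q).Infinite := by
    refine Set.infinite_of_injective_forall_mem (f := fun i : ℕ => 2 * i + 3)
      (fun i j h => by simp only at h; omega) fun i => ?_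
    rintro ⟨t, ht⟩
    cases t with
    | zero => simp at ht
    | succ t => rw [pow_succ] at ht; omega
  have hqinf' : (Set.ofPred fun m => ¬ q m).Infinite :=
    Set.infinite_of_injective_forall_mem (f := fun i : ℕ => 2 ^ i)
      (Nat.pow_right_injective le_rfl) fun i => not_not.2 ⟨i, rfl⟩
  set τ : ℕ → ℕ := fun N => if q N then s (Nat.count q N) else c (Nat.count (fun m => ¬ q m) N)
    with hτ
  have hτ1 : ∀ {N}, q N → τ N = s (Nat.count q N) := fun h => if_pos h
  have hτ2 : ∀ {N}, ¬ q N → τ N = c (Nat.count (fun m => ¬ q m) N) := fun h => if_neg h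
  have hinj : Function.Injective τ := by
    intro N N' h
    by_cases h1 : q N <;> by_cases h2 : q N'
    · rw [hτ1 h1, hτ1 h2] at h
      exact Nat.count_injective h1 h2 (hs h)
    · rw [hτ1 h1, hτ2 h2] at h
      exact absurd ⟨_, h⟩ (hcmem _)
    · rw [hτ2 h1, hτ1 h2] at h
      exact absurd ⟨_, h.symm⟩ (hcmem _)
    · rw [hτ2 h1, hτ2 h2] at h
      exact Nat.count_injective (p := fun m => ¬ q m) h1 h2 (hcinj h)
  have hsurj : Function.Surjective τ := by
    intro y
    by_cases hy : y ∈ Set.range s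
    · obtain ⟨i, rfl⟩ := hy
      exact ⟨Nat.nth q i, by
        rw [hτ1 (Nat.nth_mem_of_infinite hqinf i), Nat.count_nth_of_infinite hqinf]⟩
    · obtain ⟨i, rfl⟩ : y ∈ Set.range c := by
        rw [hc, Nat.range_nth_of_infinite hinf]; exact hy
      exact ⟨Nat.nth (fun m => ¬ q m) i, by
        rw [hτ2 (Nat.nth_mem_of_infinite hqinf' i), Nat.count_nth_of_infinite hqinf']⟩
  refine ⟨Equiv.ofBijective τ ⟨hinj, hsurj⟩, Nat.count q, fun N => Nat.count_le _, fun N => ?_,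
    Nat.surjective_count_of_infinite_setOfPred hqinf, fun g C hg N => ?_⟩
  · have h1 := count_add_count_not q N
    have h2 : Nat.count (fun m => ¬ q m) N ≤ Nat.log 2 N + 1 := by
      rw [Nat.count_eq_card_filter_range]
      have hsub : (Finset.range N).filter (fun m => ¬ q m) ⊆
          (Finset.range (Nat.log 2 N + 1)).image fun i => 2 ^ i := by
        intro m hm
        rw [Finset.mem_filter, Finset.mem_range] at hm
        obtain ⟨i, rfl⟩ := not_not.1 hm.2
        refine Finset.mem_image.2 ⟨i, Finset.mem_range.2 ?_, rfl⟩
        have := Nat.le_log_of_pow_le (b := 2) one_lt_two hm.1.le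
        omega
      exact (Finset.card_le_card hsub).trans (Finset.card_image_le.trans (by simp))
    omega
  · change |∑ k ∈ Finset.range N, g (τ k) - _| ≤ _
    induction N with
    | zero => simp
    | succ N ih =>
      rw [Finset.sum_range_succ, Nat.count_succ]
      by_cases h : q N
      · rw [if_pos h, hτ1 h, Finset.sum_range_succ]
        push_cast
        calc _ = _ := by congr 1; ring
          _ ≤ _ := ih
          _ = _ := by ring
      · rw [if_neg h, add_zero]
        have h1 := abs_add_le (∑ k ∈ Finset.range N, g (τ k)
          - ∑ i ∈ Finset.range (Nat.count q N), g (s i)) (g (τ N))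
        have h2 := hg (τ N)
        push_cast
        calc _ = |(∑ k ∈ Finset.range N, g (τ k)
              - ∑ i ∈ Finset.range (Nat.count q N), g (s i)) + g (τ N)| := by congr 1; ring
          _ ≤ _ := h1.trans (add_le_add ih h2)
          _ = _ := by ring

/-- The sequence that lists the pairs `(k p, l p)` one after the other. -/
def interleave (k l : ℕ → ℕ) (i : ℕ) : ℕ := if i % 2 = 0 then k (i / 2) else l (i / 2)

theorem interleave_even (k l : ℕ → ℕ) (p : ℕ) : interleave k l (2 * p) = k p := by
  simp [interleave]

theorem interleave_odd (k l : ℕ → ℕ) (p : ℕ) : interleave k l (2 * p + 1) = l p := by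
  have h1 : (2 * p + 1) % 2 = 1 := by omega
  have h2 : (2 * p + 1) / 2 = p := by omega
  simp [interleave, h1, h2]

theorem interleave_mem (k l : ℕ → ℕ) (i : ℕ) :
    interleave k l i = k (i / 2) ∨ interleave k l i = l (i / 2) := by
  unfold interleave
  split_ifs <;> simp

theorem sum_interleave (k l : ℕ → ℕ) (g : ℕ → ℝ) (m : ℕ) :
    ∑ i ∈ Finset.range (2 * m), g (interleave k l i) =
      ∑ p ∈ Finset.range m, (g (k p) + g (l p)) := by
  induction m with
  | zero => simp
  | succ m ih =>
    rw [Finset.sum_range_succ, ← ih, show 2 * (m + 1) = 2 * m + 1 + 1 by ring,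
      Finset.sum_range_succ, Finset.sum_range_succ, interleave_even, interleave_odd]
    ring

/-- The gap `2` leaves the index just after each pair unused. -/
theorem infinite_compl_range_interleave {k l : ℕ → ℕ}
    (h : ∀ p p', p < p' → max (k p) (l p) + 2 ≤ min (k p') (l p')) :
    {m | m ∉ Set.range (interleave k l)}.Infinite := by
  have hmono : StrictMono fun p => max (k p) (l p) + 1 := fun p p' hp => by
    have := h p p' hp
    simp only
    omega
  refine Set.infinite_of_injective_forall_mem hmono.injective fun p => ?_
  rintro ⟨i, hi⟩
  have h1 : min (k (i / 2)) (l (i / 2)) ≤ interleave k l i ∧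
      interleave k l i ≤ max (k (i / 2)) (l (i / 2)) := by
    rcases interleave_mem k l i with h | h <;> rw [h] <;> omega
  rw [hi] at h1
  rcases lt_trichotomy (i / 2) p with h2 | h2 | h2
  · have := h _ _ h2
    omega
  · rw [h2] at h1
    omega
  · have := h _ _ h2
    omega

/-! ### Orthogonality and the limiting variance -/

theorem integral_cosChar_mul {m k : ℤ} (h : |m| ≠ |k|) :
    ∫ x in (0 : ℝ)..1, cosChar m x * cosChar k x = 0 := by
  have h1 : m + k ≠ 0 := fun h' => h (by rw [show m = -k by omega, abs_neg])
  have h2 : m - k ≠ 0 := fun h' => h (by rw [show m = k by omega])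
  have hc := continuous_cosChar
  simp_rw [cosChar_mul]
  rw [intervalIntegral.integral_div, intervalIntegral.integral_add
    ((hc _).intervalIntegrable _ _) ((hc _).intervalIntegrable _ _), integral_cosChar h1,
    integral_cosChar h2]
  simp

theorem integral_cosChar_mul_self {m : ℤ} (h : m ≠ 0) :
    ∫ x in (0 : ℝ)..1, cosChar m x * cosChar m x = 1 / 2 := by
  have h1 : m + m ≠ 0 := by omega
  have hc := continuous_cosChar
  simp_rw [cosChar_mul]
  rw [intervalIntegral.integral_div, intervalIntegral.integral_add
    ((hc _).intervalIntegrable _ _) ((hc _).intervalIntegrable _ _), integral_cosChar h1, sub_self]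
  simp [cosChar_zero]

theorem integral_twoCos_mul {a b : ℤ} {n m : ℕ} :
    ∫ x in (0 : ℝ)..1, twoCos a b (n * x) * twoCos a b (m * x) =
      (∫ x in (0 : ℝ)..1, cosChar (a * n) x * cosChar (a * m) x)
      + (∫ x in (0 : ℝ)..1, cosChar (a * n) x * cosChar (b * m) x)
      + ((∫ x in (0 : ℝ)..1, cosChar (b * n) x * cosChar (a * m) x)
      + ∫ x in (0 : ℝ)..1, cosChar (b * n) x * cosChar (b * m) x) := by
  have hi : ∀ u v : ℤ, IntervalIntegrable (fun x => cosChar u x * cosChar v x) volume 0 1 :=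
    fun u v => ((continuous_cosChar u).mul (continuous_cosChar v)).intervalIntegrable _ _
  rw [← intervalIntegral.integral_add (hi _ _) (hi _ _),
    ← intervalIntegral.integral_add (hi _ _) (hi _ _),
    ← intervalIntegral.integral_add ((hi _ _).add (hi _ _)) ((hi _ _).add (hi _ _))]
  congr 1
  funext x
  rw [twoCos_mul, twoCos_mul]
  ring

theorem integral_twoCos_mul_eq_zero {a b : ℤ} {n m : ℕ} (h1 : |a * n| ≠ |a * m|)
    (h2 : |a * n| ≠ |b * m|) (h3 : |b * n| ≠ |a * m|) (h4 : |b * n| ≠ |b * m|) :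
    ∫ x in (0 : ℝ)..1, twoCos a b (n * x) * twoCos a b (m * x) = 0 := by
  rw [integral_twoCos_mul, integral_cosChar_mul h1, integral_cosChar_mul h2,
    integral_cosChar_mul h3, integral_cosChar_mul h4]
  simp

theorem integral_twoCos_mul_self {a b : ℤ} (ha : a ≠ 0) (hb : b ≠ 0) (hab : |a| ≠ |b|) {n : ℕ}
    (hn : 0 < n) : ∫ x in (0 : ℝ)..1, twoCos a b (n * x) * twoCos a b (n * x) = 1 := by
  have hn' : (n : ℤ) ≠ 0 := by omega
  have h : |a * n| ≠ |b * n| := by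
    rw [abs_mul, abs_mul]
    exact fun h => hab (mul_right_cancel₀ (abs_ne_zero.2 hn') h)
  rw [integral_twoCos_mul, integral_cosChar_mul h, integral_cosChar_mul h.symm,
    integral_cosChar_mul_self (mul_ne_zero ha hn'), integral_cosChar_mul_self (mul_ne_zero hb hn')]
  norm_num

/-- The square integral of a sum of orthonormal continuous functions. -/
theorem integral_sum_sq_of_orthonormal {g : ℕ → ℝ → ℝ} (hc : ∀ i, Continuous (g i))
    (h1 : ∀ i, ∫ x in (0 : ℝ)..1, g i x * g i x = 1)
    (h0 : ∀ i i', i < i' → ∫ x in (0 : ℝ)..1, g i x * g i' x = 0) (M : ℕ) :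
    ∫ x in (0 : ℝ)..1, (∑ i ∈ Finset.range M, g i x) ^ 2 = M := by
  induction M with
  | zero => simp
  | succ M ih =>
    have hs : Continuous fun x => ∑ i ∈ Finset.range M, g i x :=
      continuous_finsetSum _ fun i _ => hc i
    have hM := hc M
    have e : ∀ x, (∑ i ∈ Finset.range (M + 1), g i x) ^ 2 = (∑ i ∈ Finset.range M, g i x) ^ 2
        + (2 * (∑ i ∈ Finset.range M, g i x * g M x) + g M x * g M x) := fun x => by
      rw [Finset.sum_range_succ, ← Finset.sum_mul]
      ring
    simp_rw [e]
    rw [intervalIntegral.integral_add, intervalIntegral.integral_add, ih, h1,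
      intervalIntegral.integral_const_mul, intervalIntegral.integral_finsetSum,
      Finset.sum_eq_zero fun i hi => h0 i M (Finset.mem_range.1 hi)]
    · simp
    · exact fun i _ => ((hc i).mul hM).intervalIntegrable _ _
    · exact (continuous_const.mul (continuous_finsetSum _ fun i _ =>
        (hc i).mul hM)).intervalIntegrable _ _
    · exact (hM.mul hM).intervalIntegrable _ _
    · exact (hs.pow 2).intervalIntegrable _ _
    · exact ((continuous_const.mul (continuous_finsetSum _ fun i _ =>
        (hc i).mul hM)).add (hM.mul hM)).intervalIntegrable _ _

/-- Replacing all but `o(√N)` terms by bounded ones does not affect the limiting variance. -/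
theorem tendsto_variance_of_close {S : ℕ → ℝ → ℝ} {T : ℕ → ℝ → ℝ} {M : ℕ → ℕ} {r : ℕ → ℝ}
    (hS : ∀ N, Continuous (S N)) (hT : ∀ N, Continuous (T N))
    (hM : ∀ N, ∫ x in (0 : ℝ)..1, T N x ^ 2 = M N) (hMN : ∀ N, M N ≤ N)
    (hr : ∀ N : ℕ, (N : ℝ) - M N ≤ r N) (hST : ∀ N x, |S N x - T N x| ≤ r N)
    (hr0 : Tendsto (fun N : ℕ => r N / √N) atTop (𝓝 0)) :
    Tendsto (fun N : ℕ => (N : ℝ)⁻¹ * ∫ x in (0 : ℝ)..1, S N x ^ 2) atTop (𝓝 1) := by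
  have hlim : Tendsto (fun N : ℕ => (r N / √N) ^ 2 + 3 * (r N / √N)) atTop (𝓝 0) := by
    simpa using (hr0.pow 2).add (hr0.const_mul 3)
  rw [tendsto_iff_norm_sub_tendsto_zero]
  refine squeeze_zero' (Eventually.of_forall fun _ => norm_nonneg _) ?_ hlim
  filter_upwards [eventually_ge_atTop 1] with N hN
  have hN1 : (1 : ℝ) ≤ N := by exact_mod_cast hN
  have hN0 : (0 : ℝ) < N := by linarith
  have hsq : √(N : ℝ) * √N = N := Real.mul_self_sqrt hN0.le
  have hs0 : 0 < √(N : ℝ) := Real.sqrt_pos.2 hN0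
  have hs1 : 1 ≤ √(N : ℝ) := by rwa [Real.one_le_sqrt]
  have hrN : 0 ≤ r N := (abs_nonneg _).trans (hST N 0)
  have hSc := hS N
  have hTc := hT N
  have hMr : (M N : ℝ) ≤ N := by exact_mod_cast hMN N
  have hpt : ∀ x, |S N x ^ 2 - T N x ^ 2| ≤ r N ^ 2 + r N / √N * (T N x ^ 2 + N) := by
    intro x
    have h1 := hST N x
    have h2 : |S N x ^ 2 - T N x ^ 2| = |S N x - T N x| * |(S N x - T N x) + 2 * T N x| := by
      rw [← abs_mul]; congr 1; ring
    have h3 := abs_add_le (S N x - T N x) (2 * T N x)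
    rw [abs_mul, abs_two] at h3
    -- The inequality of the means with weight `√N`: it bounds the mixed term by `T²`, whose
    -- integral is known, at the cost of the null factor `r N / √N`.
    have h4 : 2 * |T N x| ≤ (T N x ^ 2 + N) / √N := by
      rw [le_div_iff₀ hs0]
      nlinarith [sq_nonneg (|T N x| - √N), sq_abs (T N x)]
    rw [h2]
    calc _ ≤ r N * (r N + (T N x ^ 2 + N) / √N) :=
          mul_le_mul h1 (h3.trans (by linarith)) (abs_nonneg _) hrN
      _ = _ := by ring
  have hint : |(∫ x in (0 : ℝ)..1, S N x ^ 2) - M N| ≤ r N ^ 2 + r N / √N * (M N + N) := by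
    rw [← hM N, ← intervalIntegral.integral_sub (Continuous.intervalIntegrable (by fun_prop) _ _)
      (Continuous.intervalIntegrable (by fun_prop) _ _)]
    refine (intervalIntegral.abs_integral_le_integral_abs zero_le_one).trans ?_
    refine (intervalIntegral.integral_mono_on zero_le_one
      (Continuous.intervalIntegrable (by fun_prop) _ _)
      (Continuous.intervalIntegrable (by fun_prop) _ _) fun x _ => hpt x).trans (le_of_eq ?_)
    rw [intervalIntegral.integral_add (by simp) (Continuous.intervalIntegrable (by fun_prop) _ _),
      intervalIntegral.integral_const_mul, intervalIntegral.integral_add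
      (Continuous.intervalIntegrable (by fun_prop) _ _) (by simp)]
    simp
  rw [Real.norm_eq_abs]
  have h5 : (N : ℝ)⁻¹ * (∫ x in (0 : ℝ)..1, S N x ^ 2) - 1 =
      ((∫ x in (0 : ℝ)..1, S N x ^ 2) - M N) / N - (N - M N) / N := by
    field_simp
    ring
  have h6 : |((∫ x in (0 : ℝ)..1, S N x ^ 2) - M N) / N| ≤ (r N / √N) ^ 2 + 2 * (r N / √N) := by
    rw [abs_div, abs_of_pos hN0, div_le_iff₀ hN0]
    refine hint.trans ?_
    have h7 : (r N / √N) ^ 2 * N = r N ^ 2 := by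
      rw [div_pow, Real.sq_sqrt hN0.le, div_mul_cancel₀ _ hN0.ne']
    have h8 : 0 ≤ r N / √N := by positivity
    nlinarith
  have h7 : |((N : ℝ) - M N) / N| ≤ r N / √N := by
    rw [abs_div, abs_of_pos hN0, abs_of_nonneg (by linarith)]
    have h8 : √(N : ℝ) ≤ N := by nlinarith
    exact div_le_div₀ hrN (hr N) hs0 h8
  rw [h5]
  exact (abs_sub _ _).trans (by linarith)

theorem tendsto_log_add_one_div_sqrt :
    Tendsto (fun N : ℕ => ((Nat.log 2 N : ℝ) + 1) / √N) atTop (𝓝 0) := by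
  have h1 : Tendsto (fun x : ℝ => Real.log x / √x) atTop (𝓝 0) := by
    have := (isLittleO_log_rpow_atTop (r := 1 / 2) (by norm_num)).tendsto_div_nhds_zero
    simpa [Real.sqrt_eq_rpow] using this
  have h2 : Tendsto (fun x : ℝ => (√x)⁻¹) atTop (𝓝 0) :=
    tendsto_inv_atTop_zero.comp Real.tendsto_sqrt_atTop
  have h3 : Tendsto (fun N : ℕ => (Real.log 2)⁻¹ * (Real.log N / √N) + (√(N : ℝ))⁻¹) atTop
      (𝓝 0) := by
    have := ((h1.const_mul (Real.log 2)⁻¹).add h2).comp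
      (tendsto_natCast_atTop_atTop (R := ℝ))
    rwa [mul_zero, add_zero] at this
  refine squeeze_zero (fun N => by positivity) (fun N => ?_) h3
  have h4 : (Nat.log 2 N : ℝ) ≤ (Real.log 2)⁻¹ * Real.log N := by
    have := Real.natLog_le_logb N 2
    rw [Real.logb] at this
    push_cast at this
    rwa [inv_mul_eq_div]
  rw [← mul_div_assoc, ← one_div (√(N : ℝ)), ← add_div]
  exact div_le_div_of_nonneg_right (by linarith) (Real.sqrt_nonneg _)

theorem admissibleFunction_twoCos {a b : ℤ} (ha : a ≠ 0) (hb : b ≠ 0) :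
    AdmissibleFunction (twoCos a b) where
  measurable := (continuous_twoCos a b).measurable
  periodic x := by
    have : ∀ m : ℤ, cosChar m (x + 1) = cosChar m x := fun m => by
      unfold cosChar
      rw [show 2 * Real.pi * (m : ℝ) * (x + 1) = 2 * Real.pi * m * x + m * (2 * Real.pi) by ring,
        Real.cos_add_int_mul_two_pi]
    simp only [twoCos, this]
  integral_eq_zero := by
    simp only [twoCos]
    rw [intervalIntegral.integral_add ((continuous_cosChar a).intervalIntegrable _ _)
      ((continuous_cosChar b).intervalIntegrable _ _), integral_cosChar ha, integral_cosChar hb,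
      add_zero]
  boundedVariation := by
    have hd : ContDiff ℝ 1 (twoCos a b) := by
      unfold twoCos cosChar
      fun_prop
    obtain ⟨C, hC⟩ := hd.contDiffOn.exists_lipschitzOnWith one_ne_zero
      (convex_Icc (0 : ℝ) 1) isCompact_Icc
    have := hC.locallyBoundedVariationOn 0 1 (by simp) (by simp)
    rwa [Set.inter_self] at this

/-! ### The mixed limit law is not Gaussian -/

/-- The Laplace transform of the law of `2 + cos (2 π x)`. -/
noncomputable def cosLaplace (s : ℝ) : ℝ :=
  ∫ x in (0 : ℝ)..1, Real.exp (-(s * (2 + cosChar 1 x)))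

theorem continuous_cosLaplace : Continuous cosLaplace := by
  have := continuous_cosChar 1
  unfold cosLaplace
  exact intervalIntegral.continuous_parametric_intervalIntegral_of_continuous'
    (by unfold Function.uncurry; fun_prop) 0 1

/-- Equality would say that `exp (-(2 + cos 2πx))` has variance zero, hence, being continuous, is
constant. Its values at `1/2` and `1/4` differ. -/
theorem cosLaplace_two_ne : cosLaplace 2 ≠ cosLaplace 1 ^ 2 := by
  intro h
  have hc := continuous_cosChar 1
  set g : ℝ → ℝ := fun x => Real.exp (-(1 * (2 + cosChar 1 x))) with hg
  have hgc : Continuous g := by fun_prop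
  have h2 : cosLaplace 2 = ∫ x in (0 : ℝ)..1, g x ^ 2 := by
    unfold cosLaplace
    congr 1
    funext x
    rw [hg, ← Real.exp_nat_mul]
    congr 1
    push_cast
    ring
  have h1 : cosLaplace 1 = ∫ x in (0 : ℝ)..1, g x := rfl
  have hvar : ∫ x in (0 : ℝ)..1, (g x - cosLaplace 1) ^ 2 = 0 := by
    have e : ∀ x, (g x - cosLaplace 1) ^ 2 =
        g x ^ 2 - 2 * cosLaplace 1 * g x + cosLaplace 1 ^ 2 := fun x => by ring
    simp_rw [e]
    rw [intervalIntegral.integral_add (Continuous.intervalIntegrable (by fun_prop) _ _) (by simp),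
      intervalIntegral.integral_sub (Continuous.intervalIntegrable (by fun_prop) _ _)
        (Continuous.intervalIntegrable (by fun_prop) _ _),
      intervalIntegral.integral_const_mul, ← h1, ← h2, h]
    simp
    ring
  have hzero : ∀ x ∈ Set.Ioo (0 : ℝ) 1, g x = cosLaplace 1 := by
    intro x hx
    by_contra hne
    have hpos : 0 < ∫ x in (0 : ℝ)..1, (g x - cosLaplace 1) ^ 2 :=
      intervalIntegral.integral_pos zero_lt_one (by fun_prop) (fun y _ => sq_nonneg _)
        ⟨x, ⟨hx.1.le, hx.2.le⟩, by have := sub_ne_zero.2 hne; positivity⟩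
    exact hpos.ne' hvar
  have e1 := hzero (1 / 2) (by constructor <;> norm_num)
  have e2 := hzero (1 / 4) (by constructor <;> norm_num)
  rw [← e2, hg] at e1
  simp only [cosChar] at e1
  have e3 : (2 * Real.pi * ((1 : ℤ) : ℝ) * (1 / 2)) = Real.pi := by push_cast; ring
  have e4 : (2 * Real.pi * ((1 : ℤ) : ℝ) * (1 / 4)) = Real.pi / 2 := by push_cast; ring
  rw [e3, e4, Real.cos_pi, Real.cos_pi_div_two, Real.exp_eq_exp] at e1
  norm_num at e1

/-- Characteristic functions of normed sums which are dominated by one block. -/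
theorem tendsto_charFun_of_blocks {S B : ℕ → ℝ → ℝ} {N K : ℕ → ℕ} {e : ℕ → ℝ}
    (hS : ∀ j, Continuous (S j)) (hB : ∀ j, Continuous (B j)) (hN : Tendsto N atTop atTop)
    (hKN : ∀ j, K j ≤ N j)
    (hK : Tendsto (fun j => (K j : ℝ) / N j) atTop (𝓝 (1 / 2)))
    (hSB : ∀ j x, |S j x - B j x| ≤ e j)
    (he : Tendsto (fun j => e j / √(N j)) atTop (𝓝 0))
    (hblock : ∀ j, ∀ l : ℝ, |l| ≤ 1 / 4 →
      ‖(∫ x in (0 : ℝ)..1, Complex.exp (Complex.I * (l * B j x : ℝ)))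
        - ∫ x in (0 : ℝ)..1, (Real.exp (-(K j * l ^ 2 / 2 * (2 + cosChar 1 x))) : ℂ)‖
        ≤ 2 * (Real.exp (K j * (64 * |l| ^ 3)) - 1)) (t : ℝ) :
    Tendsto (fun j => ∫ x in (0 : ℝ)..1, Complex.exp (Complex.I * (t * ((√(N j))⁻¹ * S j x) : ℝ)))
      atTop (𝓝 (cosLaplace (t ^ 2 / 4) : ℂ)) := by
  have hsqrt : Tendsto (fun j => √(N j : ℝ)) atTop atTop :=
    Real.tendsto_sqrt_atTop.comp (tendsto_natCast_atTop_atTop.comp hN)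
  have hl0 : Tendsto (fun j => t / √(N j : ℝ)) atTop (𝓝 0) := hsqrt.const_div_atTop t
  have hNpos : ∀ᶠ j in atTop, (0 : ℝ) < N j := by
    filter_upwards [hN.eventually_ge_atTop 1] with j hj
    exact_mod_cast hj
  have hs : Tendsto (fun j => (K j : ℝ) * (t / √(N j : ℝ)) ^ 2 / 2) atTop (𝓝 (t ^ 2 / 4)) := by
    have h1 := hK.mul_const (t ^ 2 / 2)
    rw [show 1 / 2 * (t ^ 2 / 2) = t ^ 2 / 4 by ring] at h1
    refine h1.congr' ?_
    filter_upwards [hNpos] with j hj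
    rw [div_pow, Real.sq_sqrt hj.le]
    ring
  have hmain : Tendsto (fun j => (cosLaplace ((K j : ℝ) * (t / √(N j : ℝ)) ^ 2 / 2) : ℂ)) atTop
      (𝓝 (cosLaplace (t ^ 2 / 4) : ℂ)) :=
    (Complex.continuous_ofReal.tendsto _).comp ((continuous_cosLaplace.tendsto _).comp hs)
  have hδ : Tendsto (fun j => (K j : ℝ) * (64 * |t / √(N j : ℝ)| ^ 3)) atTop (𝓝 0) := by
    have h1 : Tendsto (fun j => 64 * t ^ 2 * |t / √(N j : ℝ)|) atTop (𝓝 0) := by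
      simpa using hl0.abs.const_mul (64 * t ^ 2)
    refine squeeze_zero' (Eventually.of_forall fun j => by positivity) ?_ h1
    filter_upwards [hNpos] with j hj
    have h2 : (K j : ℝ) ≤ N j := by exact_mod_cast hKN j
    have h3 : |t / √(N j : ℝ)| ^ 2 * N j = t ^ 2 := by
      rw [sq_abs, div_pow, Real.sq_sqrt hj.le, div_mul_cancel₀ _ hj.ne']
    calc (K j : ℝ) * (64 * |t / √(N j : ℝ)| ^ 3) ≤ N j * (64 * |t / √(N j : ℝ)| ^ 3) := by gcongr
      _ = 64 * (|t / √(N j : ℝ)| ^ 2 * N j) * |t / √(N j : ℝ)| := by ring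
      _ = _ := by rw [h3]
  have hbound : Tendsto (fun j => |t| * (e j / √(N j : ℝ))
      + 2 * (Real.exp (K j * (64 * |t / √(N j : ℝ)| ^ 3)) - 1)) atTop (𝓝 0) := by
    have h1 := ((Real.continuous_exp.tendsto 0).comp hδ).sub_const 1
    simpa using (he.const_mul |t|).add (h1.const_mul 2)
  rw [← tendsto_sub_nhds_zero_iff] at hmain ⊢
  have hdiff : Tendsto (fun j =>
      (∫ x in (0 : ℝ)..1, Complex.exp (Complex.I * (t * ((√(N j))⁻¹ * S j x) : ℝ)))
      - (cosLaplace ((K j : ℝ) * (t / √(N j : ℝ)) ^ 2 / 2) : ℂ)) atTop (𝓝 0) := by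
    refine squeeze_zero_norm' ?_ hbound
    have hl4 : ∀ᶠ j in atTop, |t / √(N j : ℝ)| ≤ 1 / 4 := by
      have := hl0.abs
      rw [abs_zero] at this
      exact this.eventually_le_const (by norm_num)
    filter_upwards [hNpos, hl4] with j hj hj4
    have hb := hblock j _ hj4
    have hlap : (∫ x in (0 : ℝ)..1,
        (Real.exp (-(K j * (t / √(N j : ℝ)) ^ 2 / 2 * (2 + cosChar 1 x))) : ℂ))
        = (cosLaplace ((K j : ℝ) * (t / √(N j : ℝ)) ^ 2 / 2) : ℂ) := by
      rw [intervalIntegral.integral_ofReal]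
      rfl
    rw [hlap] at hb
    have hSc := hS j
    have hBc := hB j
    -- `u ↦ exp (iu)` is 1-Lipschitz, so the terms outside the block cost at most `|t| * e j / √(N
    -- j)`.
    have hsb : ‖(∫ x in (0 : ℝ)..1, Complex.exp (Complex.I * (t * ((√(N j))⁻¹ * S j x) : ℝ)))
        - ∫ x in (0 : ℝ)..1, Complex.exp (Complex.I * (t / √(N j : ℝ) * B j x : ℝ))‖
        ≤ |t| * (e j / √(N j : ℝ)) := by
      rw [← intervalIntegral.integral_sub (Continuous.intervalIntegrable (by fun_prop) _ _)
        (Continuous.intervalIntegrable (by fun_prop) _ _)]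
      refine (intervalIntegral.norm_integral_le_of_norm_le_const
        (C := |t| * (e j / √(N j : ℝ))) fun x _ => ?_).trans (by simp)
      have hlip : ∀ u v : ℝ,
          ‖Complex.exp (Complex.I * u) - Complex.exp (Complex.I * v)‖ ≤ |u - v| := by
        intro u v
        have h1 : Complex.exp (Complex.I * u) - Complex.exp (Complex.I * v) =
            Complex.exp (Complex.I * v) * (Complex.exp (Complex.I * (u - v : ℝ)) - 1) := by
          rw [mul_sub, ← Complex.exp_add, mul_one]
          push_cast
          ring_nf
        rw [h1, norm_mul, mul_comm Complex.I (v : ℂ), Complex.norm_exp_ofReal_mul_I, one_mul]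
        exact Real.norm_exp_I_mul_ofReal_sub_one_le
      refine (hlip _ _).trans ?_
      have h2 : t * ((√(N j : ℝ))⁻¹ * S j x) - t / √(N j : ℝ) * B j x
          = t * ((S j x - B j x) / √(N j : ℝ)) := by
        ring
      rw [h2, abs_mul, abs_div, abs_of_nonneg (Real.sqrt_nonneg _)]
      gcongr
      exact hSB j x
    rw [← sub_add_sub_cancel]
    exact (norm_add_le _ _).trans (add_le_add hsb hb)
  simpa using hdiff.add hmain

/-- Convergence in distribution on the unit interval gives convergence of the integrals of the
characters. -/
theorem tendsto_integral_exp_of_tendstoInDistribution {Y : ℕ → ℝ → ℝ}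
    {m : ℝ} {v : NNReal}
    (h : TendstoInDistribution Y atTop (id : ℝ → ℝ)
      (fun _ : ℕ => (volume : Measure ℝ).restrict (Set.Ioo 0 1)) (gaussianReal m v)) (t : ℝ) :
    Tendsto (fun N => ∫ x in (0 : ℝ)..1, Complex.exp (Complex.I * (t * Y N x : ℝ))) atTop
      (𝓝 (Complex.exp (t * m * Complex.I - v * t ^ 2 / 2))) := by
  have h1 := (ProbabilityMeasure.tendsto_iff_tendsto_charFun.1 h.tendsto) t
  simp only [ProbabilityMeasure.coe_mk, Measure.map_id, charFun_gaussianReal] at h1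
  refine h1.congr fun N => ?_
  rw [charFun_apply_real, integral_map (h.forall_aemeasurable N)
    (Continuous.aestronglyMeasurable (by fun_prop)),
    intervalIntegral.integral_of_le zero_le_one, integral_Ioc_eq_integral_Ioo]
  congr 1
  funext x
  congr 1
  push_cast
  ring

/-- Taking norms removes the mean and leaves `cosLaplace s = exp (-2vs)`. The choices `t = 2` and `t
= √8` give `s = 1` and `s = 2`. -/
theorem not_forall_cosLaplace_eq {m : ℝ} {v : NNReal} (h : ∀ t : ℝ,
    (cosLaplace (t ^ 2 / 4) : ℂ) = Complex.exp (t * m * Complex.I - v * t ^ 2 / 2)) : False := by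
  have hnn : ∀ s, 0 ≤ cosLaplace s := fun s =>
    intervalIntegral.integral_nonneg zero_le_one fun x _ => (Real.exp_pos _).le
  have hre : ∀ t : ℝ, cosLaplace (t ^ 2 / 4) = Real.exp (-(v * t ^ 2 / 2)) := by
    intro t
    have h1 := congrArg norm (h t)
    rw [Complex.norm_real, Real.norm_eq_abs, abs_of_nonneg (hnn _), Complex.norm_exp] at h1
    rw [h1]
    congr 1
    have : (t * m * Complex.I - v * t ^ 2 / 2 : ℂ) =
        ((-(v * t ^ 2 / 2) : ℝ) : ℂ) + ((t * m : ℝ) : ℂ) * Complex.I := by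
      push_cast
      ring
    rw [this, Complex.add_re, Complex.ofReal_re, Complex.re_ofReal_mul, Complex.I_re]
    ring
  refine cosLaplace_two_ne ?_
  have h1 := hre 2
  have h2 := hre (√8)
  rw [Real.sq_sqrt (by norm_num)] at h2
  norm_num at h1 h2
  rw [h1, h2, ← Real.exp_nat_mul]
  congr 1
  push_cast
  ring

/-! ### Block lengths and the proof of the theorem -/

/-- Pair offsets of the blocks: each block is much longer than all previous ones together. -/
def blockOffset : ℕ → ℕ
  | 0 => 0
  | j + 1 => (blockOffset j + 1) ^ 4

theorem strictMono_blockOffset : StrictMono blockOffset :=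
  strictMono_nat_of_lt_succ fun j =>
    (Nat.lt_succ_self _).trans_le (Nat.le_self_pow (by norm_num) _)

/-- The fourth power makes the earlier blocks negligible even against the normalization `√N`, so
they can be bounded trivially. -/
theorem blockOffset_div_sqrt_le (j : ℕ) {N : ℕ} (hN : blockOffset (j + 1) ≤ N) :
    (blockOffset j : ℝ) / √N ≤ 1 / ((j : ℝ) + 1) := by
  have h1 : ((blockOffset j : ℝ) + 1) ^ 2 ≤ √(N : ℝ) := by
    apply Real.le_sqrt_of_sq_le
    have : (((blockOffset j + 1) ^ 4 : ℕ) : ℝ) ≤ N := by exact_mod_cast hN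
    push_cast at this
    linarith [show (((blockOffset j : ℝ) + 1) ^ 2) ^ 2 = ((blockOffset j : ℝ) + 1) ^ 4 by ring]
  have h2 : (j : ℝ) ≤ blockOffset j := by exact_mod_cast strictMono_blockOffset.id_le j
  have h3 : (0 : ℝ) ≤ j := Nat.cast_nonneg j
  rw [div_le_div_iff₀ (by nlinarith) (by linarith)]
  nlinarith

/-- Here `c ≠ 0` is decisive: `a * n = -b * m` would give `c = 0`. Every other coincidence would
make a nonzero multiple of `n` or `m` as small as a multiple of `c`. -/
theorem abs_mul_ne_of_pair {a b c : ℤ} (ha : a ≠ 0) (hb : b ≠ 0) (hab : |a| ≠ |b|) (hc : c ≠ 0)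
    {D n m : ℕ} (hD : (D : ℤ) = |a| + |b|) (h : a * n + b * m = c)
    (hn : 4 * D * c.natAbs ≤ n) (hm : 4 * D * c.natAbs ≤ m) :
    |a * n| ≠ |a * m| ∧ |a * n| ≠ |b * m| ∧ |b * n| ≠ |a * m| ∧ |b * n| ≠ |b * m| := by
  have ha1 := Int.one_le_abs ha
  have hb1 := Int.one_le_abs hb
  have hc1 := Int.one_le_abs hc
  have hadd : a + b ≠ 0 := fun h => hab (by rw [show a = -b by omega, abs_neg])
  have hsub : a - b ≠ 0 := fun h => hab (by rw [show a = b by omega])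
  have hn' : 4 * (|a| + |b|) * |c| ≤ n := by
    rw [← hD, ← Int.natCast_natAbs]; exact_mod_cast hn
  have hm' : 4 * (|a| + |b|) * |c| ≤ m := by
    rw [← hD, ← Int.natCast_natAbs]; exact_mod_cast hm
  have hcn : 4 * |c| ≤ n := by nlinarith
  have hcm : 4 * |c| ≤ m := by nlinarith
  have hnm : (n : ℤ) ≠ m := by
    intro hnm
    have := le_abs_mul_sub (M := 1) (t := 0) (c := c) hadd (by omega : (0 : ℤ) < m) (by omega) hcm
      (Or.inl (by rw [← h, hnm]; ring))
    simp at this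
  refine ⟨fun h1 => ?_, fun h1 => ?_, fun h1 => ?_, fun h1 => ?_⟩
  · rw [abs_mul, abs_mul, Nat.abs_cast, Nat.abs_cast] at h1
    exact hnm (mul_left_cancel₀ (by omega) h1)
  · rcases abs_eq_abs.1 h1 with h2 | h2
    · have := le_abs_mul_sub (M := 1) (s := 2 * a) (t := 0) (c := c) (by omega)
        (by omega : (0 : ℤ) < n) (by omega) hcn (Or.inl (by rw [← h, ← h2]; ring))
      simp at this
    · exact hc (by rw [← h, h2]; ring)
  · have hsq : a ^ 2 - b ^ 2 ≠ 0 := by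
      rw [sq_sub_sq]; exact mul_ne_zero hadd hsub
    have hsq' : -a ^ 2 - b ^ 2 ≠ 0 := by
      have := pow_pos (abs_pos.2 ha) 2
      rw [sq_abs] at this
      nlinarith [sq_nonneg b]
    have hM2 : 2 * (|a| * 1) ≤ (m : ℤ) := by nlinarith
    have hc2 : 2 * (|b| * |c|) ≤ (m : ℤ) := by nlinarith
    rcases abs_eq_abs.1 h1 with h2 | h2
    · have := le_abs_of_mul_eq (t := 0) ha hsq' hM2 hc2
        (by linear_combination b * h - a * h2)
      simp at this
    · have := le_abs_of_mul_eq (t := 0) ha hsq hM2 hc2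
        (by linear_combination b * h - a * h2)
      simp at this
  · rw [abs_mul, abs_mul, Nat.abs_cast, Nat.abs_cast] at h1
    exact hnm (mul_left_cancel₀ (by omega) h1)

theorem abs_mul_ne_of_mul_le {a b : ℤ} (ha : a ≠ 0) (hb : b ≠ 0) {D n m : ℕ}
    (hD : (D : ℤ) = |a| + |b|) (hn : 0 < n) (h : (D + 1) * n ≤ m) :
    |a * n| ≠ |a * m| ∧ |a * n| ≠ |b * m| ∧ |b * n| ≠ |a * m| ∧ |b * n| ≠ |b * m| := by
  have ha1 := Int.one_le_abs ha
  have hb1 := Int.one_le_abs hb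
  have h' : (|a| + |b| + 1) * (n : ℤ) ≤ m := by rw [← hD]; exact_mod_cast h
  have hn' : (0 : ℤ) < n := by exact_mod_cast hn
  simp only [abs_mul, Nat.abs_cast]
  refine ⟨?_, ?_, ?_, ?_⟩ <;> refine ne_of_lt ?_ <;> nlinarith

theorem theorem6 (n : ℕ → ℕ) (hpos : ∀ k : ℕ, 0 < n k) (hgap : HadamardLacunary n)
    (hB2 : ¬ ConditionB2 n) :
    ∃ (f : ℝ → ℝ) (σ : Equiv.Perm ℕ), AdmissibleFunction f ∧
      (∃ γ : ℝ, Tendsto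
        (fun N : ℕ => (N : ℝ)⁻¹ * ∫ x in (0 : ℝ)..1, (permutedSum f n σ N x) ^ 2)
        atTop (𝓝 γ)) ∧
      ∀ (m : ℝ) (v : NNReal),
        ¬ TendstoInDistribution (normedSum f n σ) atTop (id : ℝ → ℝ)
          (fun _ : ℕ => (volume : Measure ℝ).restrict (Set.Ioo 0 1)) (gaussianReal m v) := by
  obtain ⟨a, b, ha, hb, hab, hblocks⟩ := exists_blocks hpos hgap hB2
  obtain ⟨D, hD⟩ : ∃ D : ℕ, (D : ℤ) = |a| + |b| := ⟨a.natAbs + b.natAbs, by simp⟩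
  have hD1 : 1 ≤ D := by have := Int.one_le_abs ha; have := abs_nonneg b; omega
  set O := blockOffset with hOdef
  have hO : StrictMono O := strictMono_blockOffset
  set L : ℕ → ℕ := fun j => 8 * D ^ 2 * (O (j + 1) - O j + 1) with hL
  have hLD : ∀ j, 4 * D ≤ L j := fun j => by
    simp only [hL]
    nlinarith [Nat.zero_le (D ^ 2 * (O (j + 1) - O j))]
  choose G hG using fun R => hgap.exists_mul_le hpos R
  -- The gap `2` leaves indices for the complement, `G (D + 1)` makes different pairs orthogonal,
  -- and `G (L j)` gives the separation needed for the characteristic function of block `j`.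
  obtain ⟨k, l, hsep, hblk⟩ := exists_pair_sequence
    (P := fun c L k l => a * (n k : ℤ) + b * (n l : ℤ) = c ∧ L * c.natAbs ≤ n k ∧
      L * c.natAbs ≤ n l) (fun K G L T => by
        obtain ⟨c, hc, k, l, h1, h2⟩ := hblocks K G L T
        refine ⟨c, hc, k, l, fun i hi => ?_, h2⟩
        obtain ⟨e1, e2, e3, e4, e5⟩ := h1 i hi
        exact ⟨⟨e1, e4, e5⟩, e2, e3⟩) hO rfl (max 2 (G (D + 1))) (fun j => G (L j)) L
  set s := interleave k l with hs
  have horth : ∀ i i', i < i' → |a * n (s i)| ≠ |a * n (s i')| ∧ |a * n (s i)| ≠ |b * n (s i')| ∧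
      |b * n (s i)| ≠ |a * n (s i')| ∧ |b * n (s i)| ≠ |b * n (s i')| := by
    intro i i' hii
    rcases (Nat.div_le_div_right hii.le : i / 2 ≤ i' / 2).eq_or_lt with he | hlt
    · have e1 : s i = k (i / 2) := by
        simp only [hs, interleave]; rw [if_pos (by omega)]
      have e2 : s i' = l (i / 2) := by
        simp only [hs, interleave]; rw [if_neg (by omega), he]
      rw [e1, e2]
      obtain ⟨j, hj1, hj2⟩ := exists_block_index hO rfl (i / 2)
      obtain ⟨c, hc, h1, -⟩ := hblk j
      obtain ⟨h2, h3, h4⟩ := h1 _ hj1 hj2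
      exact abs_mul_ne_of_pair ha hb hab hc hD h2 ((Nat.mul_le_mul_right _ (hLD j)).trans h3)
        ((Nat.mul_le_mul_right _ (hLD j)).trans h4)
    · have h1 := hsep _ _ hlt
      refine abs_mul_ne_of_mul_le ha hb hD (hpos _) (hG (D + 1) _ _ ?_)
      have h2 : s i ≤ max (k (i / 2)) (l (i / 2)) := by
        rcases interleave_mem k l i with h | h <;> rw [hs, h] <;> simp
      have h3 : min (k (i' / 2)) (l (i' / 2)) ≤ s i' := by
        rcases interleave_mem k l i' with h | h <;> rw [hs, h] <;> simp
      omega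
  have hsinj : Function.Injective s := by
    intro i i' h
    rcases lt_trichotomy i i' with hlt | he | hlt
    · exact absurd (by rw [h]) (horth i i' hlt).1
    · exact he
    · exact absurd (by rw [h]) (horth i' i hlt).1
  obtain ⟨σ, M, hM1, hM2, hMsurj, hσ⟩ := exists_perm_of_injective hsinj
    (infinite_compl_range_interleave fun p p' hp => by have := hsep p p' hp; omega)
  set f := twoCos a b with hf
  have hfc : Continuous f := continuous_twoCos a b
  set S : ℕ → ℝ → ℝ := fun N x => ∑ i ∈ Finset.range (M N), f (n (s i) * x) with hS
  have hScont : ∀ N, Continuous (S N) := fun N => by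
    simp only [hS]
    fun_prop
  have hPcont : ∀ N, Continuous (permutedSum f n σ N) := fun N => by
    unfold permutedSum
    fun_prop
  set ρ : ℕ → ℝ := fun N => (Nat.log 2 N : ℝ) + 1 with hρ
  have hMρ : ∀ N : ℕ, (N : ℝ) - M N ≤ ρ N := fun N => by
    have : (N : ℝ) ≤ M N + (Nat.log 2 N + 1) := by exact_mod_cast hM2 N
    simp only [hρ]
    linarith
  have hρ0 : ∀ N, 0 ≤ ρ N := fun N => by positivity
  have hclose : ∀ N x, |permutedSum f n σ N x - S N x| ≤ 2 * ρ N := fun N x => by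
    refine (hσ (fun i => f (n i * x)) 2 (fun i => abs_twoCos_le a b _) N).trans ?_
    linarith [hMρ N]
  have hρlim : Tendsto (fun N : ℕ => 2 * ρ N / √N) atTop (𝓝 0) := by
    have := tendsto_log_add_one_div_sqrt.const_mul 2
    rw [mul_zero] at this
    simpa only [mul_div_assoc] using this
  refine ⟨f, σ, admissibleFunction_twoCos ha hb, ⟨1, ?_⟩, fun m v hdist => ?_⟩
  · refine tendsto_variance_of_close hPcont hScont (fun N => ?_) hM1
      (fun N => (hMρ N).trans (by linarith [hρ0 N])) hclose hρlim
    exact integral_sum_sq_of_orthonormal (g := fun i x => f (n (s i) * x)) (fun i => by fun_prop)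
      (fun i => integral_twoCos_mul_self ha hb hab (hpos _)) (fun i i' hii => by
        obtain ⟨h1, h2, h3, h4⟩ := horth i i' hii
        exact integral_twoCos_mul_eq_zero h1 h2 h3 h4) (M N)
  -- At time `N j` the sum contains exactly the pairs of blocks `0` to `j`, apart from the terms at
  -- powers of two.
  · choose N hN using fun j => hMsurj (2 * O (j + 1))
    have hNO : ∀ j, 2 * O (j + 1) ≤ N j := fun j => by rw [← hN j]; exact hM1 _
    have hNtop : Tendsto N atTop atTop := by
      refine tendsto_atTop_mono (fun j => ?_) tendsto_id
      have h1 := hO.id_le (j + 1)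
      have h2 := hNO j
      simp only [id_eq] at h1 ⊢
      omega
    -- The foreign terms contribute at most `2 * ρ (N j)`, and the `O j` pairs of earlier blocks at
    -- most `4` each.
    set e : ℕ → ℝ := fun j => 2 * ρ (N j) + 4 * O j with he
    have helim : Tendsto (fun j => e j / √(N j)) atTop (𝓝 0) := by
      have h1 := hρlim.comp hNtop
      have h2 : Tendsto (fun j : ℕ => 4 * (1 / ((j : ℝ) + 1))) atTop (𝓝 0) := by
        simpa using (tendsto_one_div_add_atTop_nhds_zero_nat (𝕜 := ℝ)).const_mul 4
      have h3 : Tendsto (fun j => 4 * ((O j : ℝ) / √(N j))) atTop (𝓝 0) :=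
        squeeze_zero (fun j => by positivity) (fun j => mul_le_mul_of_nonneg_left
          (blockOffset_div_sqrt_le j (by have := hNO j; simp only [hOdef] at this; omega))
          (by norm_num)) h2
      have h4 := h1.add h3
      rw [add_zero] at h4
      refine h4.congr fun j => ?_
      simp only [he, Function.comp_apply]
      ring
    set K : ℕ → ℕ := fun j => O (j + 1) - O j with hK
    have hOK : ∀ j, O (j + 1) = O j + K j := fun j => by
      have : O j < O (j + 1) := hO (Nat.lt_succ_self j)
      simp only [hK]
      omega
    set B : ℕ → ℝ → ℝ := fun j x =>
      ∑ i ∈ Finset.range (K j), pairSum a b (n (k (O j + i))) (n (l (O j + i))) x with hB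
    have hSB : ∀ j x, |permutedSum f n σ (N j) x - B j x| ≤ e j := by
      intro j x
      have h1 := hclose (N j) x
      have h2 : S (N j) x = (∑ p ∈ Finset.range (O j), pairSum a b (n (k p)) (n (l p)) x)
          + B j x := by
        simp only [hS, hB, hN]
        rw [hs, sum_interleave k l (fun i => f (n i * x)), hOK, Finset.sum_range_add]
        rfl
      have h3 : |∑ p ∈ Finset.range (O j), pairSum a b (n (k p)) (n (l p)) x| ≤ 4 * O j := by
        refine (Finset.abs_sum_le_sum_abs _ _).trans ?_
        refine (Finset.sum_le_card_nsmul _ _ 4 fun p _ => abs_pairSum_le a b _ _ x).trans ?_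
        rw [Finset.card_range, nsmul_eq_mul, mul_comm]
      have h4 : permutedSum f n σ (N j) x - B j x = (permutedSum f n σ (N j) x - S (N j) x)
          + ∑ p ∈ Finset.range (O j), pairSum a b (n (k p)) (n (l p)) x := by
        rw [h2]; ring
      rw [h4]
      exact (abs_add_le _ _).trans (add_le_add h1 h3)
    have hKN : ∀ j, K j ≤ N j := fun j => by
      have h1 := hNO j
      have h2 := hOK j
      omega
    have hKlim : Tendsto (fun j => (K j : ℝ) / N j) atTop (𝓝 (1 / 2)) := by
      rw [tendsto_iff_norm_sub_tendsto_zero]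
      refine squeeze_zero' (Eventually.of_forall fun _ => norm_nonneg _) ?_ helim
      filter_upwards [hNtop.eventually_ge_atTop 1] with j hj
      have hN1 : (1 : ℝ) ≤ N j := by exact_mod_cast hj
      have hN0 : (0 : ℝ) < N j := by linarith
      have hs1 : 1 ≤ √(N j : ℝ) := by rwa [Real.one_le_sqrt]
      have hsN : √(N j : ℝ) ≤ N j := by nlinarith [Real.mul_self_sqrt hN0.le]
      have h1 := hMρ (N j)
      rw [hN j, hOK j] at h1
      have h2 : (2 * O j + 2 * K j : ℝ) ≤ N j := by
        have := hNO j
        rw [hOK j] at this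
        exact_mod_cast (by omega : 2 * O j + 2 * K j ≤ N j)
      push_cast at h1
      have h3 : (0 : ℝ) ≤ O j := Nat.cast_nonneg _
      have h4 := hρ0 (N j)
      have h5 : (K j : ℝ) / N j - 1 / 2 = -((N j - 2 * K j) / 2 / N j) := by
        field_simp
        ring
      rw [Real.norm_eq_abs, h5, abs_neg, abs_of_nonneg (div_nonneg (by linarith) hN0.le)]
      exact div_le_div₀ (by simp only [he]; linarith) (by simp only [he]; linarith)
        (by linarith) hsN
    have hblock : ∀ j, ∀ u : ℝ, |u| ≤ 1 / 4 →
        ‖(∫ x in (0 : ℝ)..1, Complex.exp (Complex.I * (u * B j x : ℝ)))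
          - ∫ x in (0 : ℝ)..1, (Real.exp (-(K j * u ^ 2 / 2 * (2 + cosChar 1 x))) : ℂ)‖
          ≤ 2 * (Real.exp (K j * (64 * |u| ^ 3)) - 1) := by
      intro j u hu
      obtain ⟨c, hc, h1, h2⟩ := hblk j
      have h3 := hOK j
      have h4 : ∀ i < K j, _ := fun i hi => h1 (O j + i) (by omega) (by omega)
      refine norm_charFun_block_sub_le ha hb hab hc hD (L := L j) le_rfl
        (n := fun i => n (k (O j + i))) (m := fun i => n (l (O j + i)))
        (fun i hi => (h4 i hi).1) (fun i hi => (h4 i hi).2.1) (fun i hi => (h4 i hi).2.2)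
        (fun r hr i hi => ?_) hu
      have h5 := h2 (O j + i) (O j + r) (by omega) (by omega) (by omega)
      rw [mul_max_of_nonneg _ _ (Nat.zero_le _)]
      exact max_le (le_min (hG _ _ _ (by omega)) (hG _ _ _ (by omega)))
        (le_min (hG _ _ _ (by omega)) (hG _ _ _ (by omega)))
    have hBcont : ∀ j, Continuous (B j) := fun j =>
      continuous_finsetSum _ fun i _ => continuous_pairSum _ _ _ _
    refine not_forall_cosLaplace_eq (m := m) (v := v) fun t => ?_
    exact tendsto_nhds_unique
      (tendsto_charFun_of_blocks (S := fun j => permutedSum f n σ (N j)) (fun j => hPcont _) hBcont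
        hNtop hKN hKlim hSB helim hblock t)
      ((tendsto_integral_exp_of_tendstoInDistribution hdist t).comp hNtop)
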